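/- **Setting.** An instance of a Metrical Task System (MTS) consists of a metric space $M$ of finite diameter $D$, an initial state $s_0\in M$ and cost functions $c_1,\dots,c_T\colon M\to[0,\infty]$. A solution $s_1,\dots,s_T\in M$ costs $\sum_{t=1}^T\big(c_t(s_t)+d(s_{t-1},s_t)\big)$; the least possible cost is the offline optimum. There are $\ell\ge 1$ heuristics $H_1,\dots,H_\ell$; $s^i_t$ is the state of $H_i$ at time $t$, with $s^i_0=s_0$, and the costs $f_t(i)=c_t(s_t^i)+d(s_{t-1}^i,s_t^i)$ lie in $[0,2D]$. For $k\ge1$, $\mathrm{OPT}_{\le k}$ is the minimum of $\sum_{t=1}^T\big(c_t(s_t^{i_t})+d(s_{t-1}^{i_{t-1}},s_t^{i_t})\big)$ over all $i_1,\dots,i_T$ in $\{1,\dots,\ell\}$ with at most $k$ steps $t\ge 2$ such that $i_{t-1}\ne i_t$. Let $m\ge2$. With $m$-delayed bandit access, an algorithm queries one heuristic in each step $1,\dots,T$; the query of $H_i$ at time $t$ returns $s_t^i$ if $H_i$ was queried in all steps $t-m+2,\dots,t$, and returns nothing otherwise. **Algorithm** (parameters $\epsilon,\eta,\alpha$). Draw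 independent $\beta_1,\dots,\beta_T\sim\mathrm{Bernoulli}(\epsilon)$ and independent uniform $e_t\in\{1,\dots,\ell\}$; put $\beta_0=0$. Step $0$ is an exploitation step. If $t$ is an exploitation step with $\beta_t=0$, then $t+1$ is an exploitation step. If $t$ is an exploitation step with $\beta_t=1$, then $H_{e_{t+m}}$ is queried in steps $t+1,\dots,t+m$, step $t+m$ is an exploration step, and $t+m+1$ is again an exploitation step. The learner SHARE keeps weights $w_t\in(0,\infty)^\ell$ with $w_0=(1,\dots,1)$ and the distribution $x_t=w_t/\sum_j w_t(j)$. After an exploration step $t$ it receives the loss vector $g_t$ with $g_t(e_t)=f_t(e_t)/(2D)$ and $g_t(i)=0$ for $i\neq e_t$, and sets $w_{t+1}(i)=w_t(i)e^{-\eta g_t(i)}+\frac{\alpha}{\ell}\sum_j w_t(j)(1-e^{-\eta g_t(j)})$; after all other steps $w_{t+1}=w_t$. The exploited heuristic $i_t$ is sampled as follows: $i_0$ is uniform; $i_t=i_{t-1}$ if $x_t=x_{t-1}$; otherwise, given $i_{t-1}=i$, $i_t=j$ with probability $\tau_{ij}/x_{t-1}(i)$, where $\tau$ is a transport plan from $x_{t-1}$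 to $x_t$ that moves the least possible mass $\sum_i\max(0,x_{t-1}(i)-x_t(i))$. In exploitation steps $t\geq 1$ the algorithm queries $H_{i_t}$. If the answer to the query at time $t$ is the state $s_t^{i_t}$, the algorithm goes there and puts $b_t=s_t^{i_t}$; otherwise $b_t=b_{t-1}$ (with $b_0=s_0$) and it goes to a state minimizing $d(b_t,s)+c_t(s)$ over $s\in M$ (such minimizers are assumed to exist). Its expected cost is $\mathbb E[\mathrm{ALG}]$. **Theorem.** There is a universal constant $C>0$ such that the following holds for all $D$, $\ell\ge1$, $m\ge 2$, $k\geq 1$ and all instances as above whose offline optimum is at least $2k$. Put $$\epsilon=\frac{(D\ell k)^{1/3}}{m^{4/3}\,\mathrm{OPT}_{\le k}^{1/3}},\qquad \alpha=\frac{D\ell k}{\epsilon\,\mathrm{OPT}_{\le k}}=\Big(\frac{D\ell k m^2}{\mathrm{OPT}_{\le k}}\Big)^{2/3},\qquad \gamma=\sqrt{\frac{D\ell k}{\epsilon\,\mathrm{OPT}_{\le k}}},\qquad \eta=\ln\frac1{1-\gamma},$$ and suppose that these parameters are admissible for SHARE, i.e. $\alpha\le\frac12$. Then the algorithm with these parameters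 satisfies $$\mathbb E[\mathrm{ALG}]\le \mathrm{OPT}_{\le k}+C\,(D\ell k)^{1/3}m^{2/3}\,\mathrm{OPT}_{\le k}^{2/3}\,\ln\frac{\ell^{1/3}\,\mathrm{OPT}_{\le k}^{2/3}}{(Dk)^{2/3}m^{4/3}} .$$ (If $D\ge1$ and $k$ is fixed, the condition $\alpha\le\frac12$ holds whenever $D\ell m=o(\mathrm{OPT}_{\le k}^{1/3})$ and $\mathrm{OPT}_{\le k}$ is large enough.) -/

import Mathlib

open scoped ENNReal BigOperators

namespace MTS

/-- An instance of a Metrical Task System on the metric space `M`, of length `T`, with cost functions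
`c 1, …, c T` (the value `∞` is allowed) and initial state `s₀`, together with the solutions of `ℓ`
heuristics: `state i t` is the state of the `i`-th heuristic at time `t`. All heuristics start in `s₀`. -/
structure Instance (M : Type*) [MetricSpace M] (ℓ : ℕ) where
  T : ℕ
  c : ℕ → M → ℝ≥0∞
  s₀ : M
  state : Fin ℓ → ℕ → M
  state_zero : ∀ i, state i 0 = s₀

/-! ### Costs and benchmarks -/

section Benchmarks

variable {M : Type*} [MetricSpace M] {ℓ : ℕ}

/-- The diameter `D` of the metric space. -/
noncomputable def diameter (M : Type*) [MetricSpace M] : ℝ := Metric.diam (Set.univ : Set M)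

/-- Total cost (service plus movement) of the solution `s 1, …, s T` starting in `s 0`. -/
noncomputable def Instance.pathCost (P : Instance M ℓ) (s : ℕ → M) : ℝ≥0∞ :=
  ∑ t ∈ Finset.Icc 1 P.T, (P.c t (s t) + edist (s (t - 1)) (s t))

/-- The cost of an optimal offline solution (which need not follow the heuristics). -/
noncomputable def Instance.offlineOpt (P : Instance M ℓ) : ℝ≥0∞ :=
  ⨅ (s : ℕ → M) (_ : s 0 = P.s₀), P.pathCost s

/-- `f_t(i)`, the cost incurred by the `i`-th heuristic at time `t ≥ 1`. -/
noncomputable def Instance.f (P : Instance M ℓ) (i : Fin ℓ) (t : ℕ) : ℝ≥0∞ :=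
  P.c t (P.state i t) + edist (P.state i (t - 1)) (P.state i t)

/-- `OPT_{≤ k}`: the cost of the best combination `i 1, …, i T` of the heuristics which switches
between heuristics at most `k` times (`i 0` is irrelevant: all heuristics are in `s₀` at time `0`). -/
noncomputable def Instance.optLE (P : Instance M ℓ) (k : ℕ) : ℝ≥0∞ :=
  ⨅ (i : ℕ → Fin ℓ) (_ : ((Finset.Icc 2 P.T).filter fun t => i (t - 1) ≠ i t).card ≤ k),
    P.pathCost fun t => P.state (i t) t

end Benchmarks

/-! ### The learner SHARE -/

/-- One update of the weights of SHARE with learning rate `η` and sharing parameter `α`,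
after receiving the loss vector `g`. -/
noncomputable def shareUpdate {ℓ : ℕ} (η α : ℝ) (w g : Fin ℓ → ℝ) : Fin ℓ → ℝ := fun i =>
  w i * Real.exp (-η * g i) + α * (∑ j, (w j - Real.exp (-η * g j) * w j)) / ℓ

/-! ### Rounding -/

/-- `τ p p' i j` is the mass transferred from `p i` to `p' j` by an optimal transport plan
(for the uniform metric on the indices) between the probability vectors `p` and `p'`. -/
structure IsOptimalPlan {ℓ : ℕ} (τ : (Fin ℓ → ℝ) → (Fin ℓ → ℝ) → Fin ℓ → Fin ℓ → ℝ) : Prop where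
  nonneg : ∀ p ∈ stdSimplex ℝ (Fin ℓ), ∀ p' ∈ stdSimplex ℝ (Fin ℓ), ∀ i j, 0 ≤ τ p p' i j
  source : ∀ p ∈ stdSimplex ℝ (Fin ℓ), ∀ p' ∈ stdSimplex ℝ (Fin ℓ), ∀ i, ∑ j, τ p p' i j = p i
  target : ∀ p ∈ stdSimplex ℝ (Fin ℓ), ∀ p' ∈ stdSimplex ℝ (Fin ℓ), ∀ j, ∑ i, τ p p' i j = p' j
  optimal : ∀ p ∈ stdSimplex ℝ (Fin ℓ), ∀ p' ∈ stdSimplex ℝ (Fin ℓ),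
    ∑ i, ∑ j, (if i = j then 0 else τ p p' i j) = ∑ i, max 0 (p i - p' i)

/-- The probability that `Round` moves from `i` to `j` when the distribution changes from `p` to `p'`;
if the distribution does not change, the index is kept. -/
noncomputable def roundProb {ℓ : ℕ} (τ : (Fin ℓ → ℝ) → (Fin ℓ → ℝ) → Fin ℓ → Fin ℓ → ℝ)
    (p p' : Fin ℓ → ℝ) (i j : Fin ℓ) : ℝ :=
  open Classical in
  if p' = p then (if j = i then 1 else 0) else τ p p' i j / p i

/-! ### The algorithm, for fixed outcomes of its random choices

`β t` is the exploration coin and `e t` the explored heuristic drawn for time `t`;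
`r t` is the index of the exploited heuristic at time `t`. -/

section Dynamics

/-- The control flow of the learning dynamics. `phase m β t = 0` says that `t` is an exploitation step
(`t ∈ X`); `phase m β t = j` with `1 ≤ j ≤ m` says that `t - j` is an exploitation step with
`β (t - j) = 1`. So `phase m β t = m` says that `t` is an exploration step (`t ∈ E`), and the
next step is an exploitation step again. -/
def phase (m : ℕ) (β : ℕ → Bool) : ℕ → ℕ
  | 0 => 0
  | t + 1 =>
    if phase m β t = 0 then (if β t then 1 else 0)
    else if phase m β t = m then 0
    else phase m β t + 1

/-- The heuristic queried at time `t`: the exploited one in an exploitation step; otherwise the one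
which is to be explored at the end `t + (m - phase m β t)` of the current exploration block. -/
def query {ℓ : ℕ} (m : ℕ) (β : ℕ → Bool) (e r : ℕ → Fin ℓ) (t : ℕ) : Fin ℓ :=
  if phase m β t = 0 then r t else e (t + (m - phase m β t))

variable {M : Type*} [MetricSpace M] {ℓ : ℕ}

/-- `m`-delayed bandit access: if `q 1, q 2, …` are the queried heuristics, then the query at time `t`
yields the state of `q t` if this heuristic was queried in all of the steps `t - m + 2, …, t`
(queries are made from time `1` on); otherwise the result is empty. -/
def Instance.reply (P : Instance M ℓ) (m : ℕ) (q : ℕ → Fin ℓ) (t : ℕ) : Option M :=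
  if m - 1 ≤ t ∧ ∀ j < m - 1, q (t - j) = q t then some (P.state (q t) t) else none

/-- The loss vector `g_t^{e_t}` fed to the learner in an exploration step `t`. -/
noncomputable def Instance.loss (P : Instance M ℓ) (e : ℕ → Fin ℓ) (t : ℕ) : Fin ℓ → ℝ := fun i =>
  if i = e t then (P.f i t).toReal / (2 * diameter M) else 0

/-- The weights of SHARE, updated after each exploration step. -/
noncomputable def Instance.weights (P : Instance M ℓ) (m : ℕ) (η α : ℝ) (β : ℕ → Bool)
    (e : ℕ → Fin ℓ) : ℕ → Fin ℓ → ℝ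
  | 0 => fun _ => 1
  | t + 1 =>
    if phase m β t = m then shareUpdate η α (P.weights m η α β e t) (P.loss e t)
    else P.weights m η α β e t

/-- The distribution `x_t` over the heuristics. -/
noncomputable def Instance.x (P : Instance M ℓ) (m : ℕ) (η α : ℝ) (β : ℕ → Bool)
    (e : ℕ → Fin ℓ) (t : ℕ) : Fin ℓ → ℝ := fun i =>
  P.weights m η α β e t i / ∑ j, P.weights m η α β e t j

/-- The state of the exploited heuristic at time `t`, if the replies to the queries reveal it. -/
def Instance.known (P : Instance M ℓ) (m : ℕ) (β : ℕ → Bool) (e r : ℕ → Fin ℓ) (t : ℕ) : Option M :=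
  if query m β e r t = r t then P.reply m (query m β e r) t else none

/-- `b_t`, the last known state of an exploited heuristic. -/
def Instance.base (P : Instance M ℓ) (m : ℕ) (β : ℕ → Bool) (e r : ℕ → Fin ℓ) : ℕ → M
  | 0 => P.s₀
  | t + 1 => (P.known m β e r (t + 1)).getD (P.base m β e r t)

/-- `greedy t b` minimizes `d(b, s) + c_t(s)` over all states `s` (ties are broken arbitrarily). -/
def Instance.IsGreedy (P : Instance M ℓ) (greedy : ℕ → M → M) : Prop :=
  ∀ t ∈ Finset.Icc 1 P.T, ∀ b s : M,
    edist b (greedy t b) + P.c t (greedy t b) ≤ edist b s + P.c t s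

/-- `s_t`, the state of the algorithm: that of the exploited heuristic if it is known,
otherwise a greedy step from the last known state. -/
def Instance.algState (P : Instance M ℓ) (m : ℕ) (greedy : ℕ → M → M) (β : ℕ → Bool)
    (e r : ℕ → Fin ℓ) : ℕ → M
  | 0 => P.s₀
  | t + 1 => (P.known m β e r (t + 1)).getD (greedy (t + 1) (P.base m β e r t))

lemma phase_le (m : ℕ) (β : ℕ → Bool) (t : ℕ) : phase m β t ≤ t := by
  induction t with
  | zero => simp [phase]
  | succ t ih => simp only [phase]; split_ifs <;> omega

lemma phase_sub {m : ℕ} {β : ℕ → Bool} {t : ℕ} (h : phase m β t = m) :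
    ∀ j < m, phase m β (t - j) = m - j := by
  intro j
  induction j with
  | zero => intro _; simpa using h
  | succ j ih =>
    intro hj
    have h1 := ih (by omega)
    obtain ⟨u, hu⟩ : ∃ u, t - j = u + 1 := by
      have := phase_le m β (t - j)
      exact ⟨t - j - 1, by omega⟩
    have h2 : t - (j + 1) = u := by omega
    rw [hu, phase] at h1
    rw [h2]
    split_ifs at h1 <;> omega

/-- The loss used in an exploration step `t` is available under `m`-delayed bandit access: the queries
at times `t - 1` and `t` do reveal the states of the explored heuristic `e t`. -/
theorem Instance.reply_exploration (P : Instance M ℓ) {m : ℕ} (hm : 2 ≤ m) {β : ℕ → Bool}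
    (e r : ℕ → Fin ℓ) {t : ℕ} (h : phase m β t = m) :
    P.reply m (query m β e r) (t - 1) = some (P.state (e t) (t - 1)) ∧
      P.reply m (query m β e r) t = some (P.state (e t) t) := by
  have hmt : m ≤ t := h ▸ phase_le m β t
  have hq : ∀ j < m, query m β e r (t - j) = e t := by
    intro j hj
    have h1 := phase_sub h j hj
    have h2 : t - j + (m - (m - j)) = t := by omega
    rw [query, h1, if_neg (by omega), h2]
  have h0 : query m β e r t = e t := hq 0 (by omega)
  have h1 : query m β e r (t - 1) = e t := hq 1 (by omega)
  have c1 : m - 1 ≤ t - 1 ∧ ∀ j < m - 1, query m β e r (t - 1 - j) = e t :=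
    ⟨by omega, fun j hj => by rw [Nat.sub_sub]; exact hq (1 + j) (by omega)⟩
  have c0 : m - 1 ≤ t ∧ ∀ j < m - 1, query m β e r (t - j) = e t :=
    ⟨by omega, fun j hj => hq j (by omega)⟩
  constructor
  · simp only [Instance.reply, h1]
    exact if_pos c1
  · simp only [Instance.reply, h0]
    exact if_pos c0

end Dynamics

/-! ### The random choices and the expected cost -/

section Expectation

variable {M : Type*} [MetricSpace M] {ℓ : ℕ}

/-- Outcomes of the random choices: the coins `β_1, …, β_T`, the explored heuristics `e_1, …, e_{T+m}`
(those after time `T` only determine the queries in an exploration block cut off by the end of the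
instance), and the exploited heuristics `i_0, …, i_T`. -/
abbrev Outcome (T m ℓ : ℕ) : Type := (Fin T → Bool) × (Fin (T + m) → Fin ℓ) × (Fin (T + 1) → Fin ℓ)

/-- `β_t` for `1 ≤ t ≤ T`, and `β_0 = 0`. -/
def Outcome.β {T m ℓ : ℕ} (ω : Outcome T m ℓ) (t : ℕ) : Bool :=
  if h : 1 ≤ t ∧ t ≤ T then ω.1 ⟨t - 1, by omega⟩ else false

/-- `e_t` for `1 ≤ t ≤ T + m`. -/
def Outcome.e {T m ℓ : ℕ} [NeZero ℓ] (ω : Outcome T m ℓ) (t : ℕ) : Fin ℓ :=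
  if h : 1 ≤ t ∧ t ≤ T + m then ω.2.1 ⟨t - 1, by omega⟩ else 0

/-- `i_t` for `0 ≤ t ≤ T`. -/
def Outcome.i {T m ℓ : ℕ} [NeZero ℓ] (ω : Outcome T m ℓ) (t : ℕ) : Fin ℓ :=
  if h : t ≤ T then ω.2.2 ⟨t, by omega⟩ else 0

/-- The probability of an outcome: the `β_t` are independent Bernoulli variables with parameter `ε`, the
`e_t` are independent and uniform, `i_0` is uniform, and `i_t` is produced from `i_{t-1}`
by `Round` applied to `x_{t-1}` and `x_t`, with fresh randomness. -/
noncomputable def Instance.prob [NeZero ℓ] (P : Instance M ℓ) (m : ℕ) (ε η α : ℝ)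
    (τ : (Fin ℓ → ℝ) → (Fin ℓ → ℝ) → Fin ℓ → Fin ℓ → ℝ) (ω : Outcome P.T m ℓ) : ℝ :=
  (∏ t ∈ Finset.Icc 1 P.T, if ω.β t then ε else 1 - ε) *
  (∏ _t ∈ Finset.Icc 1 (P.T + m), 1 / (ℓ : ℝ)) *
  ((1 / (ℓ : ℝ)) * ∏ t ∈ Finset.Icc 1 P.T,
    roundProb τ (P.x m η α ω.β ω.e (t - 1)) (P.x m η α ω.β ω.e t) (ω.i (t - 1)) (ω.i t))

/-- `E[ALG]`: the expected cost of the algorithm with exploration rate `ε`, using SHARE with learning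
rate `η` and sharing parameter `α` as its internal learner. -/
noncomputable def Instance.expectedCost [NeZero ℓ] (P : Instance M ℓ) (m : ℕ) (ε η α : ℝ)
    (τ : (Fin ℓ → ℝ) → (Fin ℓ → ℝ) → Fin ℓ → Fin ℓ → ℝ) (greedy : ℕ → M → M) : ℝ≥0∞ :=
  ∑ ω : Outcome P.T m ℓ, ENNReal.ofReal (P.prob m ε η α τ ω) *
    P.pathCost (P.algState m greedy ω.β ω.e ω.i)

end Expectation

/-! ### The choice of the parameters, given `D`, `ℓ`, `k`, `m` and the value `V` of `OPT_{≤ k}` -/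

/-- The exploration rate `ε`. -/
noncomputable def paramε (D ℓ k m V : ℝ) : ℝ :=
  V ^ (-(1 / 3) : ℝ) * (D * ℓ * k) ^ (1 / 3 : ℝ) * m ^ (-(4 / 3) : ℝ)

/-- The sharing parameter `α`. -/
noncomputable def paramα (D ℓ k m V : ℝ) : ℝ := D * ℓ * k / (paramε D ℓ k m V * V)

/-- The learning rate `η = ln (1 / (1 - γ))`, that is, `γ = 1 - exp (-η)`,
where `γ = √(D ℓ k / (ε V))`. -/
noncomputable def paramη (D ℓ k m V : ℝ) : ℝ :=
  Real.log (1 / (1 - Real.sqrt (D * ℓ * k / (paramε D ℓ k m V * V))))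

end MTS

/-!
A step is *settled* if none of the last `m - 1` steps belonged to an exploration. In a settled step
the algorithm knows the state of the exploited heuristic, and in an unsettled one it is greedy from
the last known state. With the distance to the exploited heuristic as potential, every unsettled
step pays at most twice what that heuristic (with its switches) has paid since the run of unsettled
steps began, so each step of the heuristic is charged `1 + 2 R` times, where `R` is the remaining
length of the run. Explorations start with probability `ε` and `m ε ≤ 3 / 8`, so unsettled steps
are rare, a run of them has expected length `O(m)`, and the overhead factor is `1 + O(m² ε)`.

For SHARE, `w i + (α / ℓ) ∑ j, w j` shrinks by at most `exp (-η g i)` in each step, and switching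
from one heuristic to another costs a factor `α / (2 ℓ)`. This bounds the loss of the learner by
that of any sequence of `k` switches. An exploration observes a given heuristic with probability
`ε / ℓ`, independently of the weights, which are constant during a block; hence the expected loss is
`ε / (2 D ℓ)` times the expected cost in the steps that can be observed, and the remaining steps are
compared with these by means of independence. With `γ = m² ε` one has `α = γ²`, and all error terms
are `O(γ V log (ℓ / α))`, where `V` is the benchmark.
-/

namespace MTS

section Phase

variable {m : ℕ} {β β' : ℕ → Bool} {s t : ℕ}

lemma phase_le_delay (hm : 1 ≤ m) (β : ℕ → Bool) (t : ℕ) : phase m β t ≤ m := by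
  induction t with
  | zero => simp [phase]
  | succ t ih => simp only [phase]; split_ifs <;> omega

lemma phase_congr (h : ∀ s < t, β s = β' s) : phase m β t = phase m β' t := by
  induction t with
  | zero => rfl
  | succ t ih => simp only [phase, ih fun s hs => h s (by omega), h t (by omega)]

lemma start_of_phase_ne_zero (h : phase m β t ≠ 0) :
    phase m β (t - phase m β t) = 0 ∧ β (t - phase m β t) = true := by
  induction t with
  | zero => simp [phase] at h
  | succ t ih =>
    simp only [phase] at h ⊢
    by_cases h0 : phase m β t = 0
    · cases hb : β t <;> simp_all
    · by_cases h1 : phase m β t = m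
      · simp_all
      · simpa [h0, h1] using ih h0

lemma phase_add_of_start (hs : phase m β s = 0) (hb : β s = true) {j : ℕ} (h1 : 1 ≤ j)
    (hj : j ≤ m) : phase m β (s + j) = j := by
  induction j, h1 using Nat.le_induction with
  | base => simp [phase, hs, hb]
  | succ j h1 ih =>
    rw [← add_assoc, phase, ih (by omega), if_neg (by omega), if_neg (by omega)]

lemma phase_add_delay_iff (hm : 1 ≤ m) :
    phase m β (s + m) = m ↔ phase m β s = 0 ∧ β s = true := by
  refine ⟨fun h => ?_, fun ⟨h, hb⟩ => phase_add_of_start h hb hm le_rfl⟩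
  simpa only [h, Nat.add_sub_cancel] using
    start_of_phase_ne_zero (m := m) (β := β) (t := s + m) (by omega)

lemma phase_succ_of_phase_eq_delay (hm : 1 ≤ m) (h : phase m β t = m) :
    phase m β (t + 1) = 0 := by
  rw [phase, h, if_neg (by omega), if_pos rfl]

lemma phase_add_ne_delay (hs : phase m β s = 0) {j : ℕ} (hj : j < m) :
    phase m β (s + j) ≠ m := by
  intro h
  have hs' := phase_sub h j hj
  rw [Nat.add_sub_cancel, hs] at hs'
  omega

lemma phase_eq_zero_of_no_start (hs : phase m β s = 0) {j : ℕ}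
    (h : ∀ i < j, β (s + i) = false) : phase m β (s + j) = 0 := by
  induction j with
  | zero => exact hs
  | succ j ih => simp [phase, ih fun i hi => h i (by omega), h j (by omega)]

end Phase

section Unsettled

variable {m : ℕ} {β β' : ℕ → Bool} {t : ℕ}

/-- The indicator of the steps `t` which are not preceded by enough exploitation steps to guarantee
that the state of the exploited heuristic is known: it is `0` if all of the steps
`t - m + 2, …, t` exist and are exploitation steps, and `1` otherwise. -/
def unsettled (m : ℕ) (β : ℕ → Bool) (t : ℕ) : ℕ :=
  if m - 1 ≤ t ∧ ∀ j < m - 1, phase m β (t - j) = 0 then 0 else 1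

/-- The length of the run of unsettled steps from `t` on, within the time horizon `T`. -/
def unsettledRun (m : ℕ) (β : ℕ → Bool) (T t : ℕ) : ℕ :=
  ∑ n ∈ Finset.range (T + 1 - t), ∏ i ∈ Finset.range (n + 1), unsettled m β (t + i)

lemma unsettled_eq_zero_iff :
    unsettled m β t = 0 ↔ m - 1 ≤ t ∧ ∀ j < m - 1, phase m β (t - j) = 0 := by
  simp [unsettled]

lemma unsettled_eq_one_of_ne_zero (h : unsettled m β t ≠ 0) : unsettled m β t = 1 := by
  unfold unsettled at h ⊢
  split_ifs at h ⊢ <;> trivial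

lemma unsettled_le_one (m : ℕ) (β : ℕ → Bool) (t : ℕ) : unsettled m β t ≤ 1 := by
  unfold unsettled
  split_ifs <;> simp

lemma unsettled_congr (h : ∀ s < t, β s = β' s) : unsettled m β t = unsettled m β' t := by
  have hphase (j : ℕ) : phase m β (t - j) = phase m β' (t - j) :=
    phase_congr fun s hs => h s (by omega)
  simp only [unsettled, hphase]

lemma unsettledRun_eq (m : ℕ) (β : ℕ → Bool) {T t : ℕ} (ht : t ≤ T) :
    unsettledRun m β T t = unsettled m β t * (1 + unsettledRun m β T (t + 1)) := by
  obtain ⟨n, rfl⟩ := Nat.exists_eq_add_of_le ht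
  unfold unsettledRun
  rw [show t + n + 1 - t = n + 1 by omega, show t + n + 1 - (t + 1) = n by omega,
    Finset.sum_range_succ', mul_add, Finset.mul_sum, add_comm (unsettled m β t * 1)]
  refine congr_arg₂ _ (Finset.sum_congr rfl fun i _ => ?_) (by simp)
  rw [Finset.prod_range_succ', mul_comm, add_zero]
  simp only [add_assoc, add_comm 1]

lemma exists_start_of_unsettled (hm : 1 ≤ m) (h : unsettled m β t ≠ 0) :
    t < m - 1 ∨ ∃ j ∈ Finset.Icc 1 (2 * m), j ≤ t ∧ phase m β (t - j) = 0 ∧ β (t - j) = true := by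
  rw [ne_eq, unsettled_eq_zero_iff, not_and_or, not_le] at h
  refine h.imp_right fun h => ?_
  push Not at h
  obtain ⟨j, hj, hp⟩ := h
  have hstart := start_of_phase_ne_zero hp
  have hle_m := phase_le_delay hm β (t - j)
  have hle_t := phase_le m β (t - j)
  rw [Nat.sub_sub] at hstart
  exact ⟨j + phase m β (t - j), Finset.mem_Icc.2 (by omega), by omega, hstart⟩

end Unsettled

section Tracking

variable {M : Type*} [PseudoEMetricSpace M]

/-- A step of a policy which tries to follow a target, with service cost `c`: from the state `b`
where the target was last seen, the policy moves to `S'` and the target to `p'`, and the last known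
state of the target becomes `b'`. If the target is revealed, then `S' = b' = p'`; otherwise `S'` is
at least as good for a greedy step from `b` as `p'`, and `u = 1` records that this has happened. -/
def IsTrackingStep (c : M → ℝ≥0∞) (u : ℕ) (b b' S' p' : M) : Prop :=
  (S' = p' ∧ b' = p') ∨ (u = 1 ∧ b' = b ∧ edist b S' + c S' ≤ edist b p' + c p')

-- `edist S b + edist b p * (1 + 2 * U)` is a potential: `U` counts the steps for which
-- the distance from `b` to the target may still have to be paid.
lemma IsTrackingStep.amortized {c : M → ℝ≥0∞} {u : ℕ} {b b' S S' p p' : M}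
    (h : IsTrackingStep c u b b' S' p') {U U' : ℝ≥0∞} (hU : U = u * (1 + U')) :
    c S' + edist S S' + edist S' b' + edist b' p' * (1 + 2 * U') ≤
      edist S b + edist b p * (1 + 2 * U) + (1 + 2 * U) * (c p' + edist p p') := by
  have hbp : edist b p' ≤ edist b p + edist p p' := edist_triangle _ _ _
  rcases h with ⟨rfl, rfl⟩ | ⟨rfl, rfl, hgreedy⟩
  · have hU1 : 1 ≤ 1 + 2 * U := le_self_add
    calc c b' + edist S b' + edist b' b' + edist b' b' * (1 + 2 * U')
        = c b' + edist S b' := by simp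
      _ ≤ c b' + (edist S b + (edist b p + edist p b')) := by
          gcongr
          exact (edist_triangle _ b _).trans (add_le_add le_rfl hbp)
      _ = edist S b + edist b p * 1 + 1 * (c b' + edist p b') := by ring
      _ ≤ _ := by gcongr
  · rw [Nat.cast_one, one_mul] at hU
    calc c S' + edist S S' + edist S' b' + edist b' p' * (1 + 2 * U')
        ≤ c S' + (edist S b' + edist b' S') + edist b' S' + edist b' p' * (1 + 2 * U') := by
          gcongr
          · exact edist_triangle _ _ _
          · rw [edist_comm]
      _ ≤ c S' + (edist S b' + edist b' S') + edist b' S' + edist b' p' * (1 + 2 * U') + c S' :=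
          le_self_add
      _ = edist S b' + 2 * (edist b' S' + c S') + edist b' p' * (1 + 2 * U') := by ring
      _ ≤ edist S b' + 2 * (edist b' p' + c p') + edist b' p' * (1 + 2 * U') := by gcongr
      _ = edist S b' + edist b' p' * (1 + 2 * U) + 2 * c p' := by rw [hU]; ring
      _ ≤ edist S b' + (edist b' p + edist p p') * (1 + 2 * U) + (1 + 2 * U) * c p' := by
          gcongr
          rw [hU]
          exact (le_mul_of_one_le_right' le_self_add).trans le_add_self
      _ = _ := by ring

end Tracking

section Pathwise

variable {M : Type*} [MetricSpace M] {ℓ : ℕ} (P : Instance M ℓ) {m : ℕ} {β : ℕ → Bool}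
  {e r : ℕ → Fin ℓ}

lemma Instance.known_eq_none_or (m : ℕ) (β : ℕ → Bool) (e r : ℕ → Fin ℓ) (t : ℕ) :
    P.known m β e r t = none ∨ P.known m β e r t = some (P.state (r t) t) := by
  unfold Instance.known Instance.reply
  split_ifs with h1 h2
  · exact .inr (by rw [h1])
  · exact .inl rfl
  · exact .inl rfl

lemma Instance.known_eq_some {T : ℕ}
    (hr : ∀ t, t + 1 ≤ T → phase m β t ≠ m → r (t + 1) = r t) {t : ℕ}
    (ht : t ≤ T) (hm : 2 ≤ m) (h : unsettled m β t = 0) :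
    P.known m β e r t = some (P.state (r t) t) := by
  obtain ⟨hmt, hexploit⟩ := unsettled_eq_zero_iff.1 h
  have hconst : ∀ j < m - 1, r (t - j) = r t := by
    intro j
    induction j with
    | zero => simp
    | succ j ih =>
      intro hj
      have hstep := hr (t - (j + 1)) (by omega) (by rw [hexploit _ hj]; omega)
      rw [← ih (by omega), ← hstep, show t - (j + 1) + 1 = t - j by omega]
  have hquery : ∀ j < m - 1, query m β e r (t - j) = r t := fun j hj => by
    rw [query, if_pos (hexploit j hj), hconst j hj]
  have hquery₀ : query m β e r t = r t := hquery 0 (by omega)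
  rw [Instance.known, if_pos hquery₀, Instance.reply, hquery₀, if_pos ⟨hmt, hquery⟩]

lemma Instance.isTrackingStep_algState {greedy : ℕ → M → M} (hg : P.IsGreedy greedy) (hm : 2 ≤ m)
    (hr : ∀ t, t + 1 ≤ P.T → phase m β t ≠ m → r (t + 1) = r t) {t : ℕ} (ht : t + 1 ≤ P.T) :
    IsTrackingStep (P.c (t + 1)) (unsettled m β (t + 1)) (P.base m β e r t)
      (P.base m β e r (t + 1)) (P.algState m greedy β e r (t + 1))
      (P.state (r (t + 1)) (t + 1)) := by
  rcases P.known_eq_none_or m β e r (t + 1) with h | h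
  · refine .inr ⟨unsettled_eq_one_of_ne_zero fun h0 => ?_, by simp [Instance.base, h], ?_⟩
    · simp [P.known_eq_some hr ht hm h0] at h
    · simpa [Instance.algState, h] using
        hg (t + 1) (Finset.mem_Icc.2 (by omega)) (P.base m β e r t) (P.state (r (t + 1)) (t + 1))
  · exact .inl (by simp [Instance.algState, Instance.base, h])

lemma Instance.pathCost_algState_le {greedy : ℕ → M → M} (hg : P.IsGreedy greedy) (hm : 2 ≤ m)
    (hr : ∀ t, t + 1 ≤ P.T → phase m β t ≠ m → r (t + 1) = r t) :
    P.pathCost (P.algState m greedy β e r) ≤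
      ∑ t ∈ Finset.Icc 1 P.T, (1 + 2 * (unsettledRun m β P.T t : ℝ≥0∞)) *
        (P.c t (P.state (r t) t) +
          edist (P.state (r (t - 1)) (t - 1)) (P.state (r t) t)) := by
  set S := P.algState m greedy β e r
  set b := P.base m β e r
  set p : ℕ → M := fun t => P.state (r t) t
  have hpotential : ∀ n, n ≤ P.T →
      ∑ t ∈ Finset.Icc 1 n, (P.c t (S t) + edist (S (t - 1)) (S t)) + (edist (S n) (b n) +
        edist (b n) (p n) * (1 + 2 * (unsettledRun m β P.T (n + 1) : ℝ≥0∞))) ≤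
      ∑ t ∈ Finset.Icc 1 n, (1 + 2 * (unsettledRun m β P.T t : ℝ≥0∞)) *
        (P.c t (p t) + edist (p (t - 1)) (p t)) := by
    intro n
    induction n with
    | zero => simp [S, b, p, P.state_zero, Instance.algState, Instance.base]
    | succ n ih =>
      intro hn
      have hstep := (P.isTrackingStep_algState (e := e) hg hm hr hn).amortized
        (S := S n) (p := p n) (U := unsettledRun m β P.T (n + 1))
        (U' := unsettledRun m β P.T (n + 2)) (by rw [unsettledRun_eq m β hn]; push_cast; rfl)
      rw [Finset.sum_Icc_succ_top (by omega), Finset.sum_Icc_succ_top (by omega),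
        Nat.add_sub_cancel]
      refine le_trans ?_ (add_le_add_left (ih (by omega)) _)
      rw [add_assoc, add_assoc (∑ t ∈ Finset.Icc 1 n, _)]
      gcongr _ + ?_
      simpa only [add_assoc] using hstep
  exact le_self_add.trans (hpotential P.T le_rfl)

lemma edist_le_diameter [BoundedSpace M] (a b : M) : edist a b ≤ ENNReal.ofReal (diameter M) := by
  rw [edist_dist]
  exact ENNReal.ofReal_le_ofReal
    (Metric.dist_le_diam_of_mem (Bornology.IsBounded.all _) trivial trivial)

lemma Instance.exploited_cost_le [BoundedSpace M] (r : ℕ → Fin ℓ) (t : ℕ) :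
    P.c t (P.state (r t) t) + edist (P.state (r (t - 1)) (t - 1)) (P.state (r t) t) ≤
      P.f (r t) t + if r (t - 1) = r t then 0 else ENNReal.ofReal (diameter M) := by
  unfold Instance.f
  rw [add_assoc]
  gcongr
  split_ifs with h
  · rw [h, add_zero]
  · exact le_add_left (edist_le_diameter _ _)

end Pathwise

section Chain

variable {σ : Type*} [Inhabited σ]

/-- The path `r` on `{0, …, n}` as a function of all times. -/
def extendPath {n : ℕ} (r : Fin (n + 1) → σ) (t : ℕ) : σ :=
  if h : t ≤ n then r ⟨t, by omega⟩ else default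

lemma extendPath_snoc {n : ℕ} (r : Fin (n + 1) → σ) (j : σ) :
    extendPath (n := n + 1) (Fin.snoc (α := fun _ => σ) r j) =
      Function.update (extendPath r) (n + 1) j := by
  funext t
  simp only [extendPath, Function.update_apply, Fin.snoc]
  rcases lt_trichotomy t (n + 1) with h | rfl | h
  · simp [show t ≤ n by omega, h.le, h, h.ne]
  · simp
  · simp [show ¬ t ≤ n by omega, h.not_ge, h.ne']

variable [Fintype σ] {q : σ → ℝ} {K : ℕ → σ → σ → ℝ}

/-- The expectation over the paths of length `n` of the Markov chain with initial distribution `q`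
and transition matrices `K 1, …, K n`. -/
noncomputable def chainExp (q : σ → ℝ) (K : ℕ → σ → σ → ℝ) (n : ℕ) : ((ℕ → σ) → ℝ) →ₗ[ℝ] ℝ :=
  ∑ r : Fin (n + 1) → σ, (q (extendPath r 0) *
    ∏ t ∈ Finset.Icc 1 n, K t (extendPath r (t - 1)) (extendPath r t)) •
      LinearMap.proj (extendPath r)

lemma chainExp_apply (n : ℕ) (g : (ℕ → σ) → ℝ) :
    chainExp q K n g = ∑ r : Fin (n + 1) → σ, (q (extendPath r 0) *
      ∏ t ∈ Finset.Icc 1 n, K t (extendPath r (t - 1)) (extendPath r t)) * g (extendPath r) := by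
  simp [chainExp, LinearMap.sum_apply]

lemma chainExp_zero (ψ : σ → ℝ) : chainExp q K 0 (fun r => ψ (r 0)) = ∑ i, q i * ψ i := by
  rw [chainExp_apply, ← (Equiv.funUnique (Fin 1) σ).symm.sum_comp]
  simp [extendPath]

lemma chainExp_succ (n : ℕ) (g : (ℕ → σ) → ℝ) :
    chainExp q K (n + 1) g =
      chainExp q K n fun r => ∑ j, K (n + 1) (r n) j * g (Function.update r (n + 1) j) := by
  simp only [chainExp_apply, Finset.mul_sum]
  rw [← (Fin.snocEquiv fun _ : Fin (n + 2) => σ).sum_comp, Fintype.sum_prod_type, Finset.sum_comm]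
  refine Finset.sum_congr rfl fun r _ => Finset.sum_congr rfl fun j _ => ?_
  have hpast : ∏ t ∈ Finset.Icc 1 n, K t (Function.update (extendPath r) (n + 1) j (t - 1))
      (Function.update (extendPath r) (n + 1) j t) =
      ∏ t ∈ Finset.Icc 1 n, K t (extendPath r (t - 1)) (extendPath r t) := by
    refine Finset.prod_congr rfl fun t ht => ?_
    rw [Finset.mem_Icc] at ht
    rw [Function.update_of_ne (by omega), Function.update_of_ne (by omega)]
  have hsnoc : extendPath (n := n + 1) ((Fin.snocEquiv fun _ : Fin (n + 2) => σ) (j, r)) =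
      Function.update (extendPath r) (n + 1) j := extendPath_snoc r j
  rw [hsnoc, Finset.prod_Icc_succ_top (by omega), hpast,
    Nat.add_sub_cancel, Function.update_self, Function.update_of_ne (by omega),
    Function.update_of_ne (by omega)]
  ring

lemma chainExp_restrict (hK : ∀ t i, ∑ j, K (t + 1) i j = 1) {n N : ℕ} (hn : n ≤ N)
    {g : (ℕ → σ) → ℝ} (hg : ∀ r r', (∀ t ≤ n, r t = r' t) → g r = g r') :
    chainExp q K N g = chainExp q K n g := by
  induction N, hn using Nat.le_induction with
  | base => rfl
  | succ N h ih =>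
    rw [chainExp_succ, ← ih]
    congr 1
    funext r
    have hupdate (j : σ) : g (Function.update r (N + 1) j) = g r :=
      hg _ _ fun t ht => Function.update_of_ne (by omega) _ _
    simp only [hupdate, ← Finset.sum_mul, hK, one_mul]

variable {x : ℕ → σ → ℝ}

lemma chainExp_last (hx : ∀ t j, ∑ i, x t i * K (t + 1) i j = x (t + 1) j) (n : ℕ) (ψ : σ → ℝ) :
    chainExp (x 0) K n (fun r => ψ (r n)) = ∑ i, x n i * ψ i := by
  induction n generalizing ψ with
  | zero => exact chainExp_zero ψ
  | succ n ih =>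
    simp only [chainExp_succ, Function.update_self]
    rw [ih fun i => ∑ j, K (n + 1) i j * ψ j]
    simp only [← hx, Finset.mul_sum, Finset.sum_mul, mul_assoc]
    exact Finset.sum_comm

lemma chainExp_transition (hx : ∀ t j, ∑ i, x t i * K (t + 1) i j = x (t + 1) j)
    (hK : ∀ t i, ∑ j, K (t + 1) i j = 1) {n N : ℕ} (hn : n < N) (ψ : σ → σ → ℝ) :
    chainExp (x 0) K N (fun r => ψ (r n) (r (n + 1))) =
      ∑ i, x n i * ∑ j, K (n + 1) i j * ψ i j := by
  rw [chainExp_restrict hK hn fun r r' h => by rw [h n (by omega), h (n + 1) le_rfl],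
    chainExp_succ, ← chainExp_last hx n]
  simp

end Chain

section Round

variable {ℓ : ℕ} {τ : (Fin ℓ → ℝ) → (Fin ℓ → ℝ) → Fin ℓ → Fin ℓ → ℝ} {p p' : Fin ℓ → ℝ}

lemma roundProb_self (p : Fin ℓ → ℝ) (i j : Fin ℓ) :
    roundProb τ p p i j = if j = i then 1 else 0 := by simp [roundProb]

lemma roundProb_nonneg (hτ : IsOptimalPlan τ) (hp : p ∈ stdSimplex ℝ (Fin ℓ))
    (hp' : p' ∈ stdSimplex ℝ (Fin ℓ)) (i j : Fin ℓ) : 0 ≤ roundProb τ p p' i j := by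
  unfold roundProb
  split_ifs
  exacts [zero_le_one, le_rfl, div_nonneg (hτ.nonneg p hp p' hp' i j) (hp.1 i)]

lemma sum_roundProb (hτ : IsOptimalPlan τ) (hp : p ∈ stdSimplex ℝ (Fin ℓ))
    (hp' : p' ∈ stdSimplex ℝ (Fin ℓ)) {i : Fin ℓ} (hi : 0 < p i) :
    ∑ j, roundProb τ p p' i j = 1 := by
  unfold roundProb
  split_ifs
  · simp
  · rw [← Finset.sum_div, hτ.source p hp p' hp' i, div_self hi.ne']

lemma mul_roundProb {i : Fin ℓ} (hi : 0 < p i) (h : p' ≠ p) (j : Fin ℓ) :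
    p i * roundProb τ p p' i j = τ p p' i j := by
  rw [roundProb, if_neg h, mul_div_cancel₀ _ hi.ne']

lemma sum_mul_roundProb (hτ : IsOptimalPlan τ) (hp : p ∈ stdSimplex ℝ (Fin ℓ))
    (hp' : p' ∈ stdSimplex ℝ (Fin ℓ)) (hpos : ∀ i, 0 < p i) (j : Fin ℓ) :
    ∑ i, p i * roundProb τ p p' i j = p' j := by
  obtain rfl | h := eq_or_ne p' p
  · simp [roundProb_self]
  · simp only [mul_roundProb (hpos _) h, hτ.target p hp p' hp' j]

lemma sum_mul_roundProb_switch (hτ : IsOptimalPlan τ) (hp : p ∈ stdSimplex ℝ (Fin ℓ))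
    (hp' : p' ∈ stdSimplex ℝ (Fin ℓ)) (hpos : ∀ i, 0 < p i) :
    ∑ i, p i * ∑ j, roundProb τ p p' i j * (if i = j then 0 else 1) =
      ∑ i, max 0 (p i - p' i) := by
  obtain rfl | h := eq_or_ne p' p
  · simp only [roundProb_self, sub_self, max_self, Finset.sum_const_zero]
    refine Finset.sum_eq_zero fun i _ => mul_eq_zero_of_right _ (Finset.sum_eq_zero fun j _ => ?_)
    by_cases hij : i = j
    · simp [hij]
    · simp [Ne.symm hij]
  · simp only [← hτ.optimal p hp p' hp', Finset.mul_sum, mul_roundProb (hpos _) h, mul_ite,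
      mul_zero, mul_one]

lemma sum_mul_roundProb_cost (hτ : IsOptimalPlan τ) (hp : p ∈ stdSimplex ℝ (Fin ℓ))
    (hp' : p' ∈ stdSimplex ℝ (Fin ℓ)) (hpos : ∀ i, 0 < p i) (f : Fin ℓ → ℝ) (D : ℝ) :
    ∑ i, p i * ∑ j, roundProb τ p p' i j * (f j + D * if i = j then 0 else 1) =
      ∑ j, p' j * f j + D * ∑ i, max 0 (p i - p' i) := by
  rw [← sum_mul_roundProb_switch hτ hp hp' hpos]
  simp only [← sum_mul_roundProb hτ hp hp' hpos, mul_add, Finset.sum_add_distrib, Finset.mul_sum,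
    Finset.sum_mul]
  congr 1
  · rw [Finset.sum_comm]
    simp only [mul_assoc]
  · simp only [mul_left_comm D]

end Round

section Share

variable {ℓ : ℕ} {η α : ℝ} {w g : Fin ℓ → ℝ}

/-- The weight removed by the losses `g`, before sharing. -/
noncomputable def lostWeight (η : ℝ) (w g : Fin ℓ → ℝ) : ℝ :=
  ∑ j, w j * (1 - Real.exp (-η * g j))

/-- The distribution proportional to the weights `w`. -/
noncomputable def normalized (w : Fin ℓ → ℝ) (i : Fin ℓ) : ℝ := w i / ∑ j, w j

lemma exp_neg_mul_le_one (hη : 0 ≤ η) {u : ℝ} (hu : 0 ≤ u) : Real.exp (-η * u) ≤ 1 :=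
  Real.exp_le_one_iff.2 (mul_nonpos_of_nonpos_of_nonneg (neg_nonpos.2 hη) hu)

lemma shareUpdate_eq (η α : ℝ) (w g : Fin ℓ → ℝ) (i : Fin ℓ) :
    shareUpdate η α w g i = w i * Real.exp (-η * g i) + α / ℓ * lostWeight η w g := by
  have hlost : ∑ j, (w j - Real.exp (-η * g j) * w j) = lostWeight η w g :=
    Finset.sum_congr rfl fun j _ => by ring
  rw [shareUpdate, hlost]
  ring

lemma shareUpdate_zero (η α : ℝ) (w : Fin ℓ → ℝ) : shareUpdate η α w 0 = w := by
  funext i; simp [shareUpdate]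

lemma lostWeight_nonneg (hη : 0 ≤ η) (hw : ∀ i, 0 ≤ w i) (hg : ∀ i, 0 ≤ g i) :
    0 ≤ lostWeight η w g :=
  Finset.sum_nonneg fun j _ => mul_nonneg (hw j) (sub_nonneg.2 (exp_neg_mul_le_one hη (hg j)))

lemma shareUpdate_pos (hη : 0 ≤ η) (hα : 0 ≤ α) (hw : ∀ i, 0 < w i) (hg : ∀ i, 0 ≤ g i)
    (i : Fin ℓ) : 0 < shareUpdate η α w g i := by
  rw [shareUpdate_eq]
  have hlost := lostWeight_nonneg hη (fun i => (hw i).le) hg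
  have hkept := mul_pos (hw i) (Real.exp_pos (-η * g i))
  positivity

lemma one_sub_exp_mul_le {u : ℝ} (h0 : 0 ≤ u) (h1 : u ≤ 1) :
    (1 - Real.exp (-η)) * u ≤ 1 - Real.exp (-η * u) := by
  have hconvex := convexOn_exp.2 (Set.mem_univ (-η)) (Set.mem_univ 0) h0 (sub_nonneg.2 h1)
    (add_sub_cancel u 1)
  simp only [smul_eq_mul, mul_zero, add_zero, Real.exp_zero, mul_one, mul_comm u] at hconvex
  linarith

lemma le_lostWeight (hw : ∀ i, 0 ≤ w i) (h0 : ∀ i, 0 ≤ g i) (h1 : ∀ i, g i ≤ 1) :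
    (1 - Real.exp (-η)) * ∑ i, w i * g i ≤ lostWeight η w g := by
  rw [Finset.mul_sum]
  refine Finset.sum_le_sum fun i _ => ?_
  rw [mul_left_comm]
  exact mul_le_mul_of_nonneg_left (one_sub_exp_mul_le (h0 i) (h1 i)) (hw i)

lemma lostWeight_le (hw : ∀ i, 0 ≤ w i) : lostWeight η w g ≤ η * ∑ i, w i * g i := by
  rw [Finset.mul_sum]
  refine Finset.sum_le_sum fun i _ => ?_
  rw [mul_left_comm]
  exact mul_le_mul_of_nonneg_left (by linarith [Real.add_one_le_exp (-η * g i)]) (hw i)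

lemma lostWeight_le_mul_sum (hη : 0 ≤ η) (hw : ∀ i, 0 ≤ w i) (h1 : ∀ i, g i ≤ 1) :
    lostWeight η w g ≤ (1 - Real.exp (-η)) * ∑ i, w i := by
  rw [Finset.mul_sum]
  refine Finset.sum_le_sum fun i _ => ?_
  have hexp : Real.exp (-η) ≤ Real.exp (-η * g i) := Real.exp_le_exp.2 (by nlinarith [h1 i])
  rw [mul_comm]
  exact mul_le_mul_of_nonneg_right (by linarith) (hw i)

lemma sum_normalized_mul (w f : Fin ℓ → ℝ) :
    ∑ i, normalized w i * f i = (∑ i, w i * f i) / ∑ i, w i := by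
  simp only [normalized, Finset.sum_div, div_mul_eq_mul_div]

variable [NeZero ℓ]

lemma sum_shareUpdate (η α : ℝ) (w g : Fin ℓ → ℝ) :
    ∑ i, shareUpdate η α w g i = ∑ i, w i - (1 - α) * lostWeight η w g := by
  have hkept : ∑ i, w i * Real.exp (-η * g i) = ∑ i, w i - lostWeight η w g := by
    rw [lostWeight, ← Finset.sum_sub_distrib]
    exact Finset.sum_congr rfl fun i _ => by ring
  have hℓ : (ℓ : ℝ) ≠ 0 := NeZero.ne _
  simp only [shareUpdate_eq, Finset.sum_add_distrib, hkept, Finset.sum_const, Finset.card_univ,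
    Fintype.card_fin, nsmul_eq_mul]
  field_simp
  ring

lemma sum_shareUpdate_mul_le {B : ℝ} {f : Fin ℓ → ℝ} (hη : 0 ≤ η) (hα : 0 ≤ α)
    (hw : ∀ i, 0 ≤ w i) (hg : ∀ i, 0 ≤ g i) (hf0 : ∀ i, 0 ≤ f i) (hf : ∀ i, f i ≤ B) :
    ∑ i, shareUpdate η α w g i * f i ≤ ∑ i, w i * f i + α * η * B * ∑ i, w i * g i := by
  have hlost := lostWeight_nonneg hη hw hg
  have hmean : (∑ i, f i) / ℓ ≤ B := by
    rw [div_le_iff₀' (Nat.cast_pos.2 (NeZero.pos ℓ))]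
    simpa using Finset.sum_le_sum fun i (_ : i ∈ Finset.univ) => hf i
  calc ∑ i, shareUpdate η α w g i * f i
      = ∑ i, w i * f i * Real.exp (-η * g i) + α * lostWeight η w g * ((∑ i, f i) / ℓ) := by
        simp only [shareUpdate_eq, add_mul, Finset.sum_add_distrib, ← Finset.mul_sum]
        congr 1
        · exact Finset.sum_congr rfl fun i _ => by ring
        · ring
    _ ≤ ∑ i, w i * f i + α * lostWeight η w g * B := by
        refine add_le_add (Finset.sum_le_sum fun i _ => ?_)
          (mul_le_mul_of_nonneg_left hmean (mul_nonneg hα hlost))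
        exact mul_le_of_le_one_right (mul_nonneg (hw i) (hf0 i)) (exp_neg_mul_le_one hη (hg i))
    _ ≤ ∑ i, w i * f i + α * (η * ∑ i, w i * g i) * B := by
        have hB : 0 ≤ B := (hf0 0).trans (hf 0)
        gcongr
        exact lostWeight_le hw
    _ = _ := by ring

lemma sum_pos_of_pos (hw : ∀ i, 0 < w i) : 0 < ∑ i, w i :=
  Finset.sum_pos (fun i _ => hw i) Finset.univ_nonempty

lemma normalized_pos (hw : ∀ i, 0 < w i) (i : Fin ℓ) : 0 < normalized w i :=
  div_pos (hw i) (sum_pos_of_pos hw)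

lemma normalized_mem_stdSimplex (hw : ∀ i, 0 < w i) : normalized w ∈ stdSimplex ℝ (Fin ℓ) :=
  ⟨fun i => (normalized_pos hw i).le, by
    simp only [normalized, ← Finset.sum_div, div_self (sum_pos_of_pos hw).ne']⟩

lemma normalized_mul_exp_le_normalized_shareUpdate (hη : 0 ≤ η) (hα : 0 ≤ α) (hα1 : α ≤ 1)
    (hw : ∀ i, 0 < w i) (hg : ∀ i, 0 ≤ g i) (i : Fin ℓ) :
    normalized w i * Real.exp (-η * g i) ≤ normalized (shareUpdate η α w g) i := by
  have hw' := shareUpdate_pos hη hα hw hg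
  have hlost := lostWeight_nonneg hη (fun i => (hw i).le) hg
  rw [normalized, div_mul_eq_mul_div]
  refine div_le_div₀ (hw' i).le ?_ (sum_pos_of_pos hw') ?_
  · rw [shareUpdate_eq]
    exact le_add_of_nonneg_right (by positivity)
  · rw [sum_shareUpdate]
    exact sub_le_self _ (mul_nonneg (sub_nonneg.2 hα1) hlost)

lemma movement_normalized_shareUpdate_le (hη : 0 ≤ η) (hα : 0 ≤ α) (hα1 : α ≤ 1)
    (hw : ∀ i, 0 < w i) (hg : ∀ i, 0 ≤ g i) :
    ∑ i, max 0 (normalized w i - normalized (shareUpdate η α w g) i) ≤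
      η * ∑ i, normalized w i * g i := by
  rw [Finset.mul_sum]
  refine Finset.sum_le_sum fun i _ => ?_
  have hp := (normalized_pos hw i).le
  refine max_le (mul_nonneg hη (mul_nonneg hp (hg i))) ?_
  have hkept := normalized_mul_exp_le_normalized_shareUpdate hη hα hα1 hw hg i
  have hexp := mul_le_mul_of_nonneg_left (Real.add_one_le_exp (-η * g i)) hp
  linarith

lemma average_shareUpdate_le {B : ℝ} {f : Fin ℓ → ℝ} (hexp : 1 / 4 ≤ Real.exp (-η)) (hη : 0 ≤ η)
    (hα : 0 ≤ α) (hw : ∀ i, 0 < w i) (hg0 : ∀ i, 0 ≤ g i) (hg1 : ∀ i, g i ≤ 1)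
    (hf0 : ∀ i, 0 ≤ f i) (hf : ∀ i, f i ≤ B) :
    ∑ i, normalized (shareUpdate η α w g) i * f i ≤
      4 * (∑ i, normalized w i * f i + α * η * B * ∑ i, normalized w i * g i) := by
  have hw0 : ∀ i, 0 ≤ w i := fun i => (hw i).le
  have hW := sum_pos_of_pos hw
  have hden : (∑ i, w i) / 4 ≤ ∑ i, shareUpdate η α w g i := by
    have hlost := lostWeight_le_mul_sum hη hw0 hg1
    have hlost0 := mul_nonneg hα (lostWeight_nonneg hη hw0 hg0)
    rw [sum_shareUpdate]
    nlinarith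
  have hnum := sum_shareUpdate_mul_le hη hα hw0 hg0 hf0 hf
  simp only [sum_normalized_mul]
  calc _ ≤ (∑ i, w i * f i + α * η * B * ∑ i, w i * g i) / ((∑ i, w i) / 4) :=
        div_le_div₀ ((Finset.sum_nonneg fun i _ => mul_nonneg (shareUpdate_pos hη hα hw hg0 i).le
          (hf0 i)).trans hnum) hnum (by positivity) hden
    _ = _ := by field_simp

end Share

section Regret

variable {ℓ : ℕ} {η α : ℝ}

/-- The number of switches of a sequence of heuristics up to time `T`. -/
def switches {κ : Type*} [DecidableEq κ] (i : ℕ → κ) (T : ℕ) : ℕ :=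
  ((Finset.Icc 2 T).filter fun t => i (t - 1) ≠ i t).card

/-- The potential of the comparator `i` in the analysis of SHARE with weights `w`. It decreases by
a factor of at most `exp (-η g)` when `i` suffers the loss `g`, and by a factor of at most
`α / (2 ℓ)` when the comparator is replaced. -/
noncomputable def sharePotential (α : ℝ) (w : Fin ℓ → ℝ) (i : Fin ℓ) : ℝ :=
  w i + α / ℓ * ∑ j, w j

lemma switches_succ {κ : Type*} [DecidableEq κ] (i : ℕ → κ) {T : ℕ} (hT : 1 ≤ T) :
    switches i (T + 1) = switches i T + if i T = i (T + 1) then 0 else 1 := by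
  rw [switches, switches, ← Finset.insert_Icc_right_eq_Icc_add_one (by omega),
    Finset.filter_insert, Nat.add_sub_cancel]
  split_ifs <;> first | rfl | contradiction | exact Finset.card_insert_of_notMem (by simp)

section Potential

variable {w g : Fin ℓ → ℝ}

lemma sharePotential_le (hα1 : α ≤ 1) (hw : ∀ i, 0 ≤ w i) (i : Fin ℓ) :
    sharePotential α w i ≤ 2 * ∑ j, w j := by
  have hℓ : (1 : ℝ) ≤ ℓ := Nat.one_le_cast.2 i.pos
  have hαℓ : α / ℓ ≤ 1 := (div_le_one (by linarith)).2 (by linarith)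
  have hi : w i ≤ ∑ j, w j := Finset.single_le_sum (fun j _ => hw j) (Finset.mem_univ i)
  have hW : α / ℓ * ∑ j, w j ≤ ∑ j, w j :=
    mul_le_of_le_one_left (Finset.sum_nonneg fun j _ => hw j) hαℓ
  unfold sharePotential
  linarith

lemma sharePotential_switch (hα : 0 ≤ α) (hα1 : α ≤ 1) (hw : ∀ i, 0 ≤ w i) (i j : Fin ℓ) :
    α / (2 * ℓ) * sharePotential α w i ≤ sharePotential α w j := by
  calc α / (2 * ℓ) * sharePotential α w i ≤ α / (2 * ℓ) * (2 * ∑ j, w j) := by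
        gcongr
        exact sharePotential_le hα1 hw i
    _ = α / ℓ * ∑ j, w j := by ring
    _ ≤ sharePotential α w j := le_add_of_nonneg_left (hw j)

lemma exp_mul_sharePotential_le [NeZero ℓ] (hη : 0 ≤ η) (hα : 0 ≤ α) (hw : ∀ i, 0 ≤ w i)
    (hg : ∀ i, 0 ≤ g i) (i : Fin ℓ) :
    Real.exp (-η * g i) * sharePotential α w i ≤
      sharePotential α (shareUpdate η α w g) i := by
  have hlost := lostWeight_nonneg hη hw hg
  have hW : 0 ≤ ∑ j, w j := Finset.sum_nonneg fun j _ => hw j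
  calc Real.exp (-η * g i) * sharePotential α w i
      = w i * Real.exp (-η * g i) + Real.exp (-η * g i) * (α / ℓ * ∑ j, w j) := by
        rw [sharePotential]; ring
    _ ≤ w i * Real.exp (-η * g i) + α / ℓ * ∑ j, w j := by
        refine add_le_add le_rfl (mul_le_of_le_one_left (by positivity) ?_)
        exact exp_neg_mul_le_one hη (hg i)
    _ ≤ w i * Real.exp (-η * g i) + α / ℓ * ∑ j, w j +
          α / ℓ * (α * lostWeight η w g) := le_add_of_nonneg_right (by positivity)
    _ = sharePotential α (shareUpdate η α w g) i := by
        rw [sharePotential, shareUpdate_eq, sum_shareUpdate]; ring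

end Potential

variable [NeZero ℓ] {w g : ℕ → Fin ℓ → ℝ}

lemma sum_weights_le (hα1 : α ≤ 1) (hu : ∀ t, w (t + 1) = shareUpdate η α (w t) (g t))
    (hw : ∀ t i, 0 < w t i) (h1 : w 1 = 1) (hg0 : ∀ t i, 0 ≤ g t i) {T : ℕ}
    (hg1 : ∀ t ∈ Finset.Icc 1 T, ∀ i, g t i ≤ 1) :
    ∑ i, w (T + 1) i ≤ ℓ * Real.exp (-((1 - α) * (1 - Real.exp (-η)) *
      ∑ t ∈ Finset.Icc 1 T, ∑ i, normalized (w t) i * g t i)) := by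
  induction T with
  | zero => simp [h1]
  | succ T ih =>
    have ih := ih fun t ht => hg1 t (by rw [Finset.mem_Icc] at ht ⊢; omega)
    have hW := sum_pos_of_pos (hw (T + 1))
    have hlost := le_lostWeight (η := η) (fun i => (hw (T + 1) i).le) (hg0 (T + 1))
      (hg1 (T + 1) (by simp))
    set W := ∑ i, w (T + 1) i
    set z := ∑ i, normalized (w (T + 1)) i * g (T + 1) i with hz
    have hloss : ∑ i, w (T + 1) i * g (T + 1) i = W * z := by
      rw [hz, sum_normalized_mul, mul_div_cancel₀ _ hW.ne']
    rw [hloss] at hlost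
    rw [Finset.sum_Icc_succ_top (by omega), mul_add, neg_add, Real.exp_add, ← mul_assoc,
      hu, sum_shareUpdate]
    calc W - (1 - α) * lostWeight η (w (T + 1)) (g (T + 1))
        ≤ W * (-((1 - α) * (1 - Real.exp (-η)) * z) + 1) := by
          linarith [mul_le_mul_of_nonneg_left hlost (sub_nonneg.2 hα1)]
      _ ≤ W * Real.exp (-((1 - α) * (1 - Real.exp (-η)) * z)) := by
          gcongr
          exact Real.add_one_le_exp _
      _ ≤ _ := by gcongr

lemma le_sharePotential (hη : 0 ≤ η) (hα : 0 ≤ α) (hα1 : α ≤ 1)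
    (hu : ∀ t, w (t + 1) = shareUpdate η α (w t) (g t)) (hw : ∀ t i, 0 < w t i) (h1 : w 1 = 1)
    (hg0 : ∀ t i, 0 ≤ g t i) (i : ℕ → Fin ℓ) {T : ℕ} (hT : 1 ≤ T) :
    (α / (2 * ℓ)) ^ switches i T * Real.exp (-η * ∑ t ∈ Finset.Icc 1 T, g t (i t)) ≤
      sharePotential α (w (T + 1)) (i T) := by
  have hupdate (t : ℕ) := exp_mul_sharePotential_le hη hα (fun j => (hw t j).le) (hg0 t) (i t)
  simp only [← hu] at hupdate
  induction T, hT using Nat.le_induction with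
  | base =>
    refine le_trans ?_ (hupdate 1)
    simpa [switches, sharePotential, h1, Real.exp_pos] using hα
  | succ T hT ih =>
    refine le_trans ?_ (hupdate (T + 1))
    rw [Finset.sum_Icc_succ_top (by omega), mul_add, Real.exp_add, ← mul_assoc,
      mul_comm _ (Real.exp (-η * g (T + 1) (i (T + 1))))]
    refine mul_le_mul_of_nonneg_left ?_ (Real.exp_pos _).le
    rw [switches_succ i hT]
    split_ifs with hsame
    · rwa [add_zero, ← hsame]
    · rw [pow_succ', mul_assoc]
      exact (mul_le_mul_of_nonneg_left ih (by positivity)).trans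
        (sharePotential_switch hα hα1 (fun j => (hw (T + 1) j).le) _ _)

theorem share_regret (hη : 0 ≤ η) (hα : 0 < α) (hα1 : α ≤ 1)
    (hu : ∀ t, w (t + 1) = shareUpdate η α (w t) (g t)) (hw : ∀ t i, 0 < w t i) (h1 : w 1 = 1)
    (hg0 : ∀ t i, 0 ≤ g t i) {T : ℕ} (hg1 : ∀ t ∈ Finset.Icc 1 T, ∀ i, g t i ≤ 1)
    (i : ℕ → Fin ℓ) :
    (1 - α) * (1 - Real.exp (-η)) * ∑ t ∈ Finset.Icc 1 T, ∑ j, normalized (w t) j * g t j ≤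
      η * ∑ t ∈ Finset.Icc 1 T, g t (i t) + (switches i T + 1) * Real.log (2 * ℓ / α) := by
  have hℓ : (1 : ℝ) ≤ ℓ := Nat.one_le_cast.2 (NeZero.pos ℓ)
  rcases T.eq_zero_or_pos with rfl | hT
  · simpa [switches] using Real.log_nonneg ((one_le_div hα).2 (by linarith))
  have hpot := (le_sharePotential hη hα.le hα1 hu hw h1 hg0 i hT).trans
    ((sharePotential_le hα1 (fun j => (hw (T + 1) j).le) (i T)).trans
      (mul_le_mul_of_nonneg_left (sum_weights_le hα1 hu hw h1 hg0 hg1) zero_le_two))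
  have hlog := Real.log_le_log (by positivity) hpot
  rw [← mul_assoc, Real.log_mul (by positivity) (by positivity),
    Real.log_mul (by positivity) (by positivity), Real.log_pow, Real.log_exp, Real.log_exp,
    show α / (2 * ℓ) = (2 * ℓ / α)⁻¹ from (inv_div _ _).symm, Real.log_inv] at hlog
  have hinitial : Real.log (2 * ℓ) ≤ Real.log (2 * ℓ / α) :=
    Real.log_le_log (by positivity) (le_div_self (by positivity) hα hα1)
  linarith

end Regret

lemma sum_prod_resample {ι κ : Type*} [Fintype ι] [DecidableEq ι] [Fintype κ] {p : κ → ℝ}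
    (hp : ∑ c, p c = 1) (s : ι) (F : (ι → κ) → ℝ) :
    ∑ b : ι → κ, (∏ i, p (b i)) * F b =
      ∑ c, p c * ∑ b : ι → κ, (∏ i, p (b i)) * F (Function.update b s c) := by
  let swap (x : (ι → κ) × κ) : (ι → κ) × κ := (Function.update x.1 s x.2, x.1 s)
  have hswap : Function.Involutive swap := fun x => by simp [swap]
  have hweight (x : (ι → κ) × κ) :
      p (swap x).2 * ∏ i, p ((swap x).1 i) = p x.2 * ∏ i, p (x.1 i) := by
    rw [← Finset.mul_prod_erase _ _ (Finset.mem_univ s),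
      ← Finset.mul_prod_erase _ (fun i => p (x.1 i)) (Finset.mem_univ s), mul_left_comm]
    have hrest : ∏ i ∈ Finset.univ.erase s, p (Function.update x.1 s x.2 i) =
        ∏ i ∈ Finset.univ.erase s, p (x.1 i) :=
      Finset.prod_congr rfl fun i hi => by rw [Function.update_of_ne (Finset.ne_of_mem_erase hi)]
    simp only [swap, Function.update_self, hrest]
  calc ∑ b : ι → κ, (∏ i, p (b i)) * F b
      = ∑ x : (ι → κ) × κ, p x.2 * (∏ i, p (x.1 i)) * F x.1 := by
        simp only [Fintype.sum_prod_type, mul_assoc, ← Finset.sum_mul, hp, one_mul]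
    _ = ∑ x : (ι → κ) × κ, p x.2 * (∏ i, p (x.1 i)) * F (swap x).1 := by
        rw [← Equiv.sum_comp hswap.toPerm]
        exact Finset.sum_congr rfl fun x _ => congrArg (· * _) (hweight x)
    _ = _ := by simp only [Fintype.sum_prod_type_right, Finset.mul_sum, mul_assoc, swap]

section Draws

variable {κ : Type*} [Inhabited κ]

/-- The draws `b` at the times `1, …, N` as a function of all times. -/
def extendDraws {N : ℕ} (b : Fin N → κ) (t : ℕ) : κ :=
  if h : 1 ≤ t ∧ t ≤ N then b ⟨t - 1, by omega⟩ else default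

lemma extendDraws_update {N : ℕ} (b : Fin N → κ) {s : ℕ} (hs : 1 ≤ s) (hs' : s ≤ N) (c : κ) :
    extendDraws (Function.update b ⟨s - 1, by omega⟩ c) =
      Function.update (extendDraws b) s c := by
  funext t
  rcases eq_or_ne t s with rfl | hts
  · simp [extendDraws, hs, hs']
  · rw [Function.update_of_ne hts]
    unfold extendDraws
    split_ifs with h
    · rw [Function.update_of_ne (by simp only [ne_eq, Fin.mk.injEq]; omega)]
    · rfl

variable [Fintype κ]

/-- The expectation over independent draws with distribution `p` at the times `1, …, N`. -/
noncomputable def drawExp (p : κ → ℝ) (N : ℕ) : ((ℕ → κ) → ℝ) →ₗ[ℝ] ℝ :=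
  ∑ b : Fin N → κ, (∏ i, p (b i)) • LinearMap.proj (extendDraws b)

variable {p : κ → ℝ} {N : ℕ} {F G : (ℕ → κ) → ℝ}

lemma drawExp_apply (F : (ℕ → κ) → ℝ) :
    drawExp p N F = ∑ b : Fin N → κ, (∏ i, p (b i)) * F (extendDraws b) := by
  simp [drawExp, LinearMap.sum_apply]

lemma drawExp_mono (hp : ∀ c, 0 ≤ p c) (h : ∀ b, (∀ t, t = 0 ∨ N < t → b t = default) → F b ≤ G b) :
    drawExp p N F ≤ drawExp p N G := by
  simp only [drawExp_apply]
  refine Finset.sum_le_sum fun b _ => mul_le_mul_of_nonneg_left (h _ fun t ht => ?_)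
    (Finset.prod_nonneg fun i _ => hp _)
  exact dif_neg (by omega)

lemma drawExp_const (hp : ∑ c, p c = 1) (a : ℝ) : drawExp p N (fun _ => a) = a := by
  rw [drawExp_apply, ← Finset.sum_mul, ← Fintype.prod_sum fun (_ : Fin N) (c : κ) => p c]
  simp [hp]

lemma drawExp_resample (hp : ∑ c, p c = 1) {s : ℕ} (hs : 1 ≤ s) (hs' : s ≤ N)
    (F : (ℕ → κ) → ℝ) :
    drawExp p N F = ∑ c, p c * drawExp p N fun b => F (Function.update b s c) := by
  simp only [drawExp_apply]
  rw [sum_prod_resample hp ⟨s - 1, by omega⟩]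
  simp only [extendDraws_update _ hs hs']

end Draws

/-- Random variables which are functions of the coins and of the explored heuristics. -/
abbrev CoinVar (ℓ : ℕ) : Type := (ℕ → Bool) → (ℕ → Fin ℓ) → ℝ

section DependsOnPast

variable {ℓ s t : ℕ} {φ φ' : CoinVar ℓ}

/-- `φ` depends only on the coins and the explored heuristics drawn before time `t`. -/
def DependsOnPast (t : ℕ) (φ : CoinVar ℓ) : Prop :=
  ∀ β β' e e', (∀ s < t, β s = β' s) → (∀ s < t, e s = e' s) → φ β e = φ β' e'

lemma DependsOnPast.mono (h : DependsOnPast s φ) (hst : s ≤ t) : DependsOnPast t φ :=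
  fun β β' e e' hβ he =>
    h β β' e e' (fun i hi => hβ i (by omega)) fun i hi => he i (by omega)

lemma DependsOnPast.mul (h : DependsOnPast t φ) (h' : DependsOnPast t φ') :
    DependsOnPast t (φ * φ') := fun β β' e e' hβ he =>
  congrArg₂ (· * ·) (h β β' e e' hβ he) (h' β β' e e' hβ he)

lemma DependsOnPast.add (h : DependsOnPast t φ) (h' : DependsOnPast t φ') :
    DependsOnPast t (φ + φ') := fun β β' e e' hβ he =>
  congrArg₂ (· + ·) (h β β' e e' hβ he) (h' β β' e e' hβ he)

lemma DependsOnPast.smul (h : DependsOnPast t φ) (a : ℝ) : DependsOnPast t (a • φ) :=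
  fun β β' e e' hβ he => congrArg (a * ·) (h β β' e e' hβ he)

end DependsOnPast

section CoinExp

variable {ℓ : ℕ} [NeZero ℓ]

/-- The expectation over independent coins at the times `1, …, T`, which are successful with
probability `ε`, and independent uniform explored heuristics at the times `1, …, N`. -/
noncomputable def coinExp (T N : ℕ) (ε : ℝ) : CoinVar ℓ →ₗ[ℝ] ℝ :=
  drawExp (fun b : Bool => if b then ε else 1 - ε) T ∘ₗ
    (drawExp (fun _ : Fin ℓ => 1 / (ℓ : ℝ)) N).compLeft (ℕ → Bool)

variable {T N : ℕ} {ε : ℝ} {φ φ' : CoinVar ℓ}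

lemma sum_bernoulli (ε : ℝ) : ∑ b : Bool, (if b then ε else 1 - ε) = 1 := by simp

lemma sum_uniform (ℓ : ℕ) [NeZero ℓ] : ∑ _i : Fin ℓ, 1 / (ℓ : ℝ) = 1 := by
  simp [NeZero.ne (ℓ : ℝ)]

lemma coinExp_apply (φ : CoinVar ℓ) :
    coinExp T N ε φ = drawExp (fun b : Bool => if b then ε else 1 - ε) T fun β =>
      drawExp (fun _ : Fin ℓ => 1 / (ℓ : ℝ)) N (φ β) := rfl

lemma coinExp_mono (h0 : 0 ≤ ε) (h1 : ε ≤ 1)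
    (h : ∀ β e, (∀ t, t = 0 ∨ T < t → β t = false) → φ β e ≤ φ' β e) :
    coinExp T N ε φ ≤ coinExp T N ε φ' := by
  refine drawExp_mono (fun b => ?_) fun β hβ => drawExp_mono (fun _ => by positivity) fun e _ => ?_
  · split_ifs <;> linarith
  · exact h β e hβ

lemma coinExp_congr (h0 : 0 ≤ ε) (h1 : ε ≤ 1)
    (h : ∀ β e, (∀ t, t = 0 ∨ T < t → β t = false) → φ β e = φ' β e) :
    coinExp T N ε φ = coinExp T N ε φ' :=
  le_antisymm (coinExp_mono h0 h1 fun β e hβ => (h β e hβ).le)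
    (coinExp_mono h0 h1 fun β e hβ => (h β e hβ).ge)

lemma coinExp_const (a : ℝ) : coinExp T N ε (fun _ (_ : ℕ → Fin ℓ) => a) = a := by
  rw [coinExp_apply, drawExp_const (sum_uniform ℓ), drawExp_const (sum_bernoulli ε)]

lemma coinExp_nonneg (h0 : 0 ≤ ε) (h1 : ε ≤ 1) (h : 0 ≤ φ) : 0 ≤ coinExp T N ε φ :=
  (map_zero (coinExp T N ε)).symm.le.trans (coinExp_mono h0 h1 fun β e _ => h β e)

lemma coinExp_coin {s : ℕ} (hs : 1 ≤ s) (hs' : s ≤ T) (hφ : DependsOnPast s φ) (ψ : Bool → ℝ) :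
    coinExp T N ε (fun β e => ψ (β s) * φ β e) =
      (ε * ψ true + (1 - ε) * ψ false) * coinExp T N ε φ := by
  have hpast (β : ℕ → Bool) (c : Bool) (e : ℕ → Fin ℓ) : φ (Function.update β s c) e = φ β e :=
    hφ _ _ _ _ (fun t ht => Function.update_of_ne ht.ne _ _) fun _ _ => rfl
  have houter (c : Bool) (F : (ℕ → Bool) → ℝ) :
      drawExp (fun b : Bool => if b then ε else 1 - ε) T (fun β => ψ c * F β) =
        ψ c * drawExp (fun b : Bool => if b then ε else 1 - ε) T F := map_smul _ (ψ c) F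
  have hinner (β : ℕ → Bool) (c : Bool) :
      drawExp (fun _ : Fin ℓ => 1 / (ℓ : ℝ)) N (fun e => ψ c * φ β e) =
        ψ c * drawExp (fun _ : Fin ℓ => 1 / (ℓ : ℝ)) N (φ β) := map_smul _ (ψ c) (φ β)
  rw [coinExp_apply, coinExp_apply, drawExp_resample (sum_bernoulli ε) hs hs']
  simp only [Function.update_self, hpast, hinner, houter, Fintype.sum_bool, if_true,
    Bool.false_eq_true, if_false]
  ring

lemma coinExp_coin_le (h0 : 0 ≤ ε) (h1 : ε ≤ 1) {s : ℕ} (hs : 1 ≤ s) (hφ : DependsOnPast s φ)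
    (hφ0 : 0 ≤ φ) :
    coinExp T N ε (fun β e => (if β s then 1 else 0) * φ β e) ≤ ε * coinExp T N ε φ := by
  rcases le_or_gt s T with hs' | hs'
  · rw [coinExp_coin hs hs' hφ fun c => if c then 1 else 0]
    simp
  · rw [coinExp_congr (φ' := 0) h0 h1 fun β e hβ => by simp [hβ s (.inr hs')], map_zero]
    exact mul_nonneg h0 (coinExp_nonneg h0 h1 hφ0)

lemma coinExp_explored {s : ℕ} (hs : 1 ≤ s) (hs' : s ≤ N) {Ψ : Fin ℓ → CoinVar ℓ}
    (hΨ : ∀ i β e j, Ψ i β (Function.update e s j) = Ψ i β e) :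
    coinExp T N ε (fun β e => Ψ (e s) β e) = 1 / ℓ * ∑ i, coinExp T N ε (Ψ i) := by
  rw [← map_sum, ← smul_eq_mul, ← map_smul, coinExp_apply, coinExp_apply]
  congr 1
  funext β
  rw [drawExp_resample (sum_uniform ℓ) hs hs']
  simp only [Function.update_self, hΨ, ← Finset.mul_sum]
  rw [← map_sum, ← smul_eq_mul, ← map_smul]
  congr 1
  funext e
  simp

end CoinExp

section Runs

lemma sum_range_mul_pow_div {ρ : ℝ} (hρ : ρ ≠ 1) {d : ℕ} (hd : 0 < d) (k : ℕ) :
    ∑ i ∈ Finset.range (d * k), ρ ^ (i / d) = d * ((ρ ^ k - 1) / (ρ - 1)) := by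
  rw [← geom_sum_eq hρ]
  induction k with
  | zero => simp
  | succ k ih =>
    have hblock (i : ℕ) (hi : i ∈ Finset.range d) : ρ ^ ((d * k + i) / d) = ρ ^ k := by
      rw [Nat.mul_add_div hd, Nat.div_eq_of_lt (Finset.mem_range.1 hi), add_zero]
    rw [mul_add_one, Finset.sum_range_add, ih, Finset.sum_congr rfl hblock, Finset.sum_range_succ,
      mul_add]
    simp

lemma sum_pow_div_le {ρ : ℝ} (h0 : 0 ≤ ρ) (h1 : ρ < 1) {d : ℕ} (hd : 0 < d) (n : ℕ) :
    ∑ i ∈ Finset.range n, ρ ^ (i / d) ≤ d / (1 - ρ) := by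
  calc ∑ i ∈ Finset.range n, ρ ^ (i / d) ≤ ∑ i ∈ Finset.range (d * n), ρ ^ (i / d) :=
        Finset.sum_le_sum_of_subset_of_nonneg (Finset.range_mono (Nat.le_mul_of_pos_left n hd))
          fun _ _ _ => by positivity
    _ = d * ((1 - ρ ^ n) / (1 - ρ)) := by
        rw [sum_range_mul_pow_div h1.ne hd, ← neg_sub 1 ρ, ← neg_sub 1 (ρ ^ n), neg_div_neg_eq]
    _ ≤ d * (1 / (1 - ρ)) := mul_le_mul_of_nonneg_left
        (div_le_div_of_nonneg_right (sub_le_self _ (pow_nonneg h0 n)) (sub_pos.2 h1).le)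
        (Nat.cast_nonneg d)
    _ = d / (1 - ρ) := mul_one_div _ _

variable {m t : ℕ} {β : ℕ → Bool}

/-- The number of successful coins in the `q`-th window of length `2 m` after time `t`. -/
noncomputable def windowHits (m t : ℕ) (β : ℕ → Bool) (q : ℕ) : ℝ :=
  ∑ j ∈ Finset.range (2 * m), if β (t + 2 * m * q + j) then 1 else 0

lemma windowHits_nonneg (m t : ℕ) (β : ℕ → Bool) (q : ℕ) : 0 ≤ windowHits m t β q :=
  Finset.sum_nonneg fun _ _ => by split_ifs <;> simp

lemma one_le_windowHits (hm : 1 ≤ m) {q : ℕ} (h : unsettled m β (t + 2 * m * (q + 1)) ≠ 0) :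
    1 ≤ windowHits m t β q := by
  rw [mul_add_one] at h
  rcases exists_start_of_unsettled hm h with h | ⟨j, hj, -, -, hcoin⟩
  · omega
  · rw [Finset.mem_Icc] at hj
    rw [show t + (2 * m * q + 2 * m) - j = t + 2 * m * q + (2 * m - j) by omega] at hcoin
    have hhit := Finset.single_le_sum
      (f := fun j => if β (t + 2 * m * q + j) then (1 : ℝ) else 0)
      (fun _ _ => by split_ifs <;> simp) (Finset.mem_range.2 (by omega : 2 * m - j < 2 * m))
    simpa only [hcoin, if_true, windowHits] using hhit

lemma prod_unsettled_le (hm : 1 ≤ m) (β : ℕ → Bool) (t n : ℕ) :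
    ((∏ i ∈ Finset.range (n + 1), unsettled m β (t + i) : ℕ) : ℝ) ≤
      unsettled m β t * ∏ q ∈ Finset.range (n / (2 * m)), windowHits m t β q := by
  by_cases h : ∃ i ∈ Finset.range (n + 1), unsettled m β (t + i) = 0
  · rw [Finset.prod_eq_zero_iff.2 h, Nat.cast_zero]
    exact mul_nonneg (Nat.cast_nonneg _) (Finset.prod_nonneg fun q _ => windowHits_nonneg m t β q)
  · push Not at h
    have hone (i : ℕ) (hi : i ∈ Finset.range (n + 1)) : unsettled m β (t + i) = 1 :=
      unsettled_eq_one_of_ne_zero (h i hi)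
    rw [Finset.prod_eq_one hone, show unsettled m β t = 1 from hone 0 (by simp), Nat.cast_one,
      one_mul]
    refine Finset.prod_induction _ (1 ≤ ·) (fun _ _ => one_le_mul_of_one_le_of_one_le) le_rfl
      fun q hq => one_le_windowHits hm (h _ ?_)
    have hwindow := Nat.mul_le_of_le_div (2 * m) (q + 1) n (Finset.mem_range.1 hq)
    rw [mul_comm] at hwindow
    exact Finset.mem_range.2 (by omega)

variable {ℓ : ℕ}

lemma dependsOnPast_windowHits (m t k : ℕ) :
    DependsOnPast (t + 2 * m * k) fun β (_ : ℕ → Fin ℓ) =>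
      ∏ q ∈ Finset.range k, windowHits m t β q := by
  intro β β' e e' hβ _
  refine Finset.prod_congr rfl fun q hq => Finset.sum_congr rfl fun j hj => ?_
  rw [Finset.mem_range] at hq hj
  have hwindow : 2 * m * (q + 1) ≤ 2 * m * k := Nat.mul_le_mul_left _ hq
  rw [mul_add_one] at hwindow
  rw [hβ _ (by omega)]

lemma dependsOnPast_unsettled (m t : ℕ) :
    DependsOnPast t fun β (_ : ℕ → Fin ℓ) => (unsettled m β t : ℝ) :=
  fun _ _ _ _ hβ _ => congrArg Nat.cast (unsettled_congr hβ)

variable [NeZero ℓ] {T N : ℕ} {ε : ℝ} {φ : CoinVar ℓ}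

lemma coinExp_windowHits_le (h0 : 0 ≤ ε) (h1 : ε ≤ 1) (ht : 1 ≤ t) (hφ : DependsOnPast t φ)
    (hφ0 : 0 ≤ φ) (k : ℕ) :
    coinExp T N ε (fun β e => φ β e * ∏ q ∈ Finset.range k, windowHits m t β q) ≤
      (2 * m * ε) ^ k * coinExp T N ε φ := by
  induction k with
  | zero => simp
  | succ k ih =>
    set ψ : CoinVar ℓ := fun β e => φ β e * ∏ q ∈ Finset.range k, windowHits m t β q
    have hψ : DependsOnPast (t + 2 * m * k) ψ :=
      (hφ.mono (by omega)).mul (dependsOnPast_windowHits m t k)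
    have hψ0 : 0 ≤ ψ := fun β e =>
      mul_nonneg (hφ0 β e) (Finset.prod_nonneg fun q _ => windowHits_nonneg m t β q)
    have hlast : (fun β e => φ β e * ∏ q ∈ Finset.range (k + 1), windowHits m t β q) =
        ∑ j ∈ Finset.range (2 * m), fun β e =>
          (if β (t + 2 * m * k + j) then 1 else 0) * ψ β e := by
      funext β e
      simp only [Finset.prod_range_succ, Finset.sum_apply, ← Finset.sum_mul, ψ, windowHits]
      ring
    calc _ = ∑ j ∈ Finset.range (2 * m), coinExp T N ε fun β e =>
          (if β (t + 2 * m * k + j) then 1 else 0) * ψ β e := by rw [hlast, map_sum]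
      _ ≤ ∑ _j ∈ Finset.range (2 * m), ε * coinExp T N ε ψ :=
          Finset.sum_le_sum fun j _ =>
            coinExp_coin_le h0 h1 (by omega) (hψ.mono (by omega)) hψ0
      _ = 2 * m * ε * coinExp T N ε ψ := by simp [mul_assoc]
      _ ≤ 2 * m * ε * ((2 * m * ε) ^ k * coinExp T N ε φ) := by gcongr
      _ = _ := by ring

lemma coinExp_unsettledRun_le (hm : 1 ≤ m) (h0 : 0 ≤ ε) (h1 : ε ≤ 1) (hε : 2 * m * ε ≤ 3 / 4)
    (ht : 1 ≤ t) (hφ : DependsOnPast t φ) (hφ0 : 0 ≤ φ) :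
    coinExp T N ε (fun β e => unsettledRun m β T t * φ β e) ≤
      8 * m * coinExp T N ε fun β e => unsettled m β t * φ β e := by
  set ψ : CoinVar ℓ := fun β e => unsettled m β t * φ β e
  have hψ : DependsOnPast t ψ := (dependsOnPast_unsettled m t).mul hφ
  have hψ0 : 0 ≤ ψ := fun β e => mul_nonneg (Nat.cast_nonneg _) (hφ0 β e)
  calc coinExp T N ε (fun β e => unsettledRun m β T t * φ β e)
      ≤ coinExp T N ε (∑ n ∈ Finset.range (T + 1 - t), fun β e =>
          ψ β e * ∏ q ∈ Finset.range (n / (2 * m)), windowHits m t β q) := by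
        refine coinExp_mono h0 h1 fun β e _ => ?_
        simp only [unsettledRun, Nat.cast_sum, Finset.sum_mul, Finset.sum_apply]
        refine Finset.sum_le_sum fun n _ => ?_
        rw [mul_right_comm]
        exact mul_le_mul_of_nonneg_right (prod_unsettled_le hm β t n) (hφ0 β e)
    _ ≤ ∑ n ∈ Finset.range (T + 1 - t), (2 * m * ε) ^ (n / (2 * m)) * coinExp T N ε ψ := by
        rw [map_sum]
        exact Finset.sum_le_sum fun n _ => coinExp_windowHits_le h0 h1 ht hψ hψ0 _
    _ ≤ ((2 * m : ℕ) : ℝ) / (1 - 2 * m * ε) * coinExp T N ε ψ := by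
        rw [← Finset.sum_mul]
        exact mul_le_mul_of_nonneg_right (sum_pow_div_le (by positivity) (by linarith) (by omega) _)
          (coinExp_nonneg h0 h1 hψ0)
    _ ≤ 8 * m * coinExp T N ε ψ := by
        refine mul_le_mul_of_nonneg_right ?_ (coinExp_nonneg h0 h1 hψ0)
        rw [div_le_iff₀ (by linarith), Nat.cast_mul, Nat.cast_two]
        nlinarith [(Nat.cast_nonneg m : (0 : ℝ) ≤ m)]

end Runs

section Dynamics

variable {M : Type*} [MetricSpace M] {ℓ m s t : ℕ} {β β' : ℕ → Bool} {e e' : ℕ → Fin ℓ}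

/-- The indicator function of an event which is determined by the coins. -/
noncomputable def coinIndicator (p : (ℕ → Bool) → Prop) [DecidablePred p] : CoinVar ℓ :=
  fun β _ => if p β then 1 else 0

section Indicator

variable (p : (ℕ → Bool) → Prop) [DecidablePred p]

lemma coinIndicator_nonneg : 0 ≤ (coinIndicator p : CoinVar ℓ) := fun β _ => by
  simp only [coinIndicator, Pi.zero_apply]
  split_ifs <;> simp

lemma coinIndicator_le_one : (coinIndicator p : CoinVar ℓ) ≤ 1 := fun β _ => by
  simp only [coinIndicator, Pi.one_apply]
  split_ifs <;> simp

end Indicator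

/-- The indicator of the event that `s` is an exploitation step. -/
noncomputable abbrev exploits (m s : ℕ) : CoinVar ℓ := coinIndicator fun β => phase m β s = 0

/-- The indicator of the event that `s` is an exploitation step after which an exploration block
starts. -/
noncomputable abbrev starts (m s : ℕ) : CoinVar ℓ :=
  coinIndicator fun β => phase m β s = 0 ∧ β s = true

/-- The indicator of the event that `s` is an exploration step. -/
noncomputable abbrev explores (m s : ℕ) : CoinVar ℓ := coinIndicator fun β => phase m β s = m

lemma starts_eq_mul (m s : ℕ) (β : ℕ → Bool) (e : ℕ → Fin ℓ) :
    starts m s β e = (if β s then 1 else 0) * exploits m s β e := by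
  simp only [coinIndicator, ← ite_and, mul_ite, mul_one, mul_zero]

lemma explores_add (hm : 1 ≤ m) (s : ℕ) : (explores m (s + m) : CoinVar ℓ) = starts m s := by
  funext β e
  simp only [coinIndicator, phase_add_delay_iff hm]

lemma explores_eq_zero (hm : 1 ≤ m) (ht : t ≤ m) (hβ : β 0 = false) : explores m t β e = 0 := by
  refine if_neg fun h => ?_
  have hphase := phase_le m β t
  obtain rfl : t = 0 + m := by omega
  simpa [hβ] using ((phase_add_delay_iff hm).1 h).2

lemma starts_zero (hβ : β 0 = false) : starts m 0 β e = 0 :=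
  if_neg (by simp [hβ])

lemma dependsOnPast_exploits (m s : ℕ) : DependsOnPast s (exploits m s : CoinVar ℓ) := by
  intro β β' e e' hβ _
  simp only [coinIndicator, phase_congr hβ]

lemma dependsOnPast_explores (m s : ℕ) : DependsOnPast s (explores m s : CoinVar ℓ) := by
  intro β β' e e' hβ _
  simp only [coinIndicator, phase_congr hβ]

lemma one_le_exploits_add_sum_starts (hm : 1 ≤ m) (t : ℕ) (β : ℕ → Bool) (e : ℕ → Fin ℓ) :
    1 ≤ exploits m t β e + ∑ j ∈ Finset.range m, starts m (t - (j + 1)) β e := by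
  have hnonneg (j : ℕ) (_ : j ∈ Finset.range m) : 0 ≤ starts m (t - (j + 1)) β e :=
    coinIndicator_nonneg _ β e
  by_cases hphase : phase m β t = 0
  · rw [exploits, coinIndicator, if_pos hphase]
    exact le_add_of_nonneg_right (Finset.sum_nonneg hnonneg)
  · have hle := phase_le_delay hm β t
    have hstart : starts m (t - (phase m β t - 1 + 1)) β e = 1 := if_pos (by
      rw [Nat.sub_add_cancel (Nat.pos_of_ne_zero hphase)]
      exact start_of_phase_ne_zero hphase)
    exact hstart.symm.le.trans <| (Finset.single_le_sum hnonneg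
      (Finset.mem_range.2 (by omega))).trans
      (le_add_of_nonneg_left (coinIndicator_nonneg _ β e))

lemma unsettled_le_sum_starts (hm : 1 ≤ m) (t : ℕ) (β : ℕ → Bool) (e : ℕ → Fin ℓ) :
    (unsettled m β t : ℝ) ≤
      (if t < m then 1 else 0) + ∑ j ∈ Finset.range (m + m), starts m (t - (j + 1)) β e := by
  have hnonneg (j : ℕ) (_ : j ∈ Finset.range (m + m)) : 0 ≤ starts m (t - (j + 1)) β e :=
    coinIndicator_nonneg _ β e
  have hsum := Finset.sum_nonneg hnonneg
  have hif : (0 : ℝ) ≤ if t < m then 1 else 0 := by split_ifs <;> simp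
  by_cases hu : unsettled m β t = 0
  · rw [hu, Nat.cast_zero]
    positivity
  · rw [unsettled_eq_one_of_ne_zero hu, Nat.cast_one]
    rcases exists_start_of_unsettled hm hu with hearly | ⟨j, hj, -, hstart⟩
    · rw [if_pos (by omega)]
      linarith
    · rw [Finset.mem_Icc] at hj
      have hsingle := Finset.single_le_sum hnonneg (Finset.mem_range.2 (by omega : j - 1 < m + m))
      rw [Nat.sub_add_cancel hj.1, starts, coinIndicator, if_pos hstart] at hsingle
      linarith

namespace Instance

lemma loss_congr (P : Instance M ℓ) (he : e t = e' t) : P.loss e t = P.loss e' t := by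
  funext i
  simp only [Instance.loss, he]

lemma weights_congr (P : Instance M ℓ) {η α : ℝ} (hβ : ∀ s < t, β s = β' s)
    (he : ∀ s < t, e s = e' s) : P.weights m η α β e t = P.weights m η α β' e' t := by
  induction t with
  | zero => rfl
  | succ t ih =>
    rw [Instance.weights, Instance.weights, phase_congr fun s hs => hβ s (by omega),
      ih (fun s hs => hβ s (by omega)) fun s hs => he s (by omega),
      P.loss_congr (he t t.lt_succ_self)]

lemma weights_succ (P : Instance M ℓ) (m : ℕ) (η α : ℝ) (β : ℕ → Bool) (e : ℕ → Fin ℓ) (t : ℕ) :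
    P.weights m η α β e (t + 1) = shareUpdate η α (P.weights m η α β e t)
      fun i => explores m t β e * P.loss e t i := by
  rw [Instance.weights]
  simp only [coinIndicator]
  split_ifs
  · simp only [one_mul]
  · simp only [zero_mul]
    exact (shareUpdate_zero η α _).symm

lemma x_eq_normalized (P : Instance M ℓ) (m : ℕ) (η α : ℝ) (β : ℕ → Bool)
    (e : ℕ → Fin ℓ) (t : ℕ) : P.x m η α β e t = normalized (P.weights m η α β e t) := rfl

/-- The average cost at time `t` under the distribution `x_s` of the learner at time `s`. -/
noncomputable def meanCost (P : Instance M ℓ) (m : ℕ) (η α : ℝ) (s t : ℕ) : CoinVar ℓ :=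
  fun β e => ∑ i, P.x m η α β e s i * (P.f i t).toReal

/-- The average loss of the learner at time `t`, if `t` is an exploration step. -/
noncomputable def learnerLoss (P : Instance M ℓ) (m : ℕ) (η α : ℝ) (t : ℕ) : CoinVar ℓ :=
  fun β e => ∑ i, P.x m η α β e t i * P.loss e t i

section

variable {η α : ℝ}

lemma dependsOnPast_x (P : Instance M ℓ) (s : ℕ) (i : Fin ℓ) :
    DependsOnPast s fun β e => P.x m η α β e s i := fun _ _ _ _ hβ he => by
  simp only [Instance.x, P.weights_congr hβ he]

lemma dependsOnPast_meanCost (P : Instance M ℓ) (s t : ℕ) :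
    DependsOnPast s (P.meanCost m η α s t) := fun _ _ _ _ hβ he => by
  simp only [Instance.meanCost, Instance.x, P.weights_congr hβ he]

variable {P : Instance M ℓ}

lemma learnerLoss_eq (t : ℕ) (β : ℕ → Bool) (e : ℕ → Fin ℓ) :
    P.learnerLoss m η α t β e =
      P.x m η α β e t (e t) * ((P.f (e t) t).toReal / (2 * diameter M)) := by
  simp [Instance.learnerLoss, Instance.loss]

lemma weights_add_of_exploits (hs : phase m β s = 0) {j : ℕ} (hj : j ≤ m) :
    P.weights m η α β e (s + j) = P.weights m η α β e s := by
  induction j with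
  | zero => rfl
  | succ j ih =>
    rw [← add_assoc, Instance.weights, if_neg (phase_add_ne_delay hs (by omega)), ih (by omega)]

lemma weights_after_block (hm : 1 ≤ m) (hs : phase m β s = 0) (hb : β s = true) {j : ℕ}
    (hj : j + 1 ≤ m) : P.weights m η α β e (s + m + (j + 1)) =
      shareUpdate η α (P.weights m η α β e s) (P.loss e (s + m)) := by
  have hend : phase m β (s + m) = m := phase_add_of_start hs hb hm le_rfl
  rw [add_comm j, ← add_assoc,
    weights_add_of_exploits (phase_succ_of_phase_eq_delay hm hend) (by omega), Instance.weights,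
    if_pos hend, weights_add_of_exploits hs le_rfl]

lemma exploits_mul_meanCost_add (s : ℕ) {j : ℕ} (hj : j ≤ m) (t : ℕ) :
    exploits m s * P.meanCost m η α (s + j) t = exploits m s * P.meanCost m η α s t := by
  funext β e
  by_cases hs : phase m β s = 0
  · simp only [Pi.mul_apply, Instance.meanCost, Instance.x, weights_add_of_exploits hs hj]
  · simp only [Pi.mul_apply, coinIndicator, if_neg hs, zero_mul]

lemma starts_mul_meanCost_add (s : ℕ) {j : ℕ} (hj : j ≤ m) (t : ℕ) :
    starts m s * P.meanCost m η α (s + j) t = starts m s * P.meanCost m η α s t := by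
  funext β e
  simp only [Pi.mul_apply, starts_eq_mul, mul_assoc]
  exact congrArg _ (congrFun₂ (exploits_mul_meanCost_add s hj t) β e)

end

/-- The assumptions of the analysis on the instance and on the parameters. -/
structure Admissible (P : Instance M ℓ) (m : ℕ) (ε η α : ℝ) : Prop where
  two_le : 2 ≤ m
  diam_pos : 0 < diameter M
  cost_le : ∀ i, ∀ t ∈ Finset.Icc 1 P.T, P.f i t ≤ ENNReal.ofReal (2 * diameter M)
  η_nonneg : 0 ≤ η
  quarter_le_exp : 1 / 4 ≤ Real.exp (-η)
  α_pos : 0 < α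
  α_le : α ≤ 1 / 2
  ε_pos : 0 < ε
  mε_le : 2 * m * ε ≤ 3 / 4

namespace Admissible

variable {P : Instance M ℓ} {ε η α : ℝ}

lemma one_le (h : P.Admissible m ε η α) : 1 ≤ m := one_le_two.trans h.two_le

lemma ε_le_one (h : P.Admissible m ε η α) : ε ≤ 1 := by
  have hm : (2 : ℝ) ≤ m := Nat.ofNat_le_cast.2 h.two_le
  nlinarith [h.mε_le, mul_le_mul_of_nonneg_right hm h.ε_pos.le]

lemma half_le_pow (h : P.Admissible m ε η α) {j : ℕ} (hj : j ≤ m) : 1 / 2 ≤ (1 - ε) ^ j := by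
  have hbernoulli := one_add_mul_le_pow (a := -ε) (by linarith [h.ε_le_one]) j
  have hjε : j * ε ≤ m * ε := mul_le_mul_of_nonneg_right (Nat.cast_le.2 hj) h.ε_pos.le
  rw [← sub_eq_add_neg] at hbernoulli
  linarith [h.mε_le]

lemma cost_toReal_le (h : P.Admissible m ε η α) (ht : t ∈ Finset.Icc 1 P.T) (i : Fin ℓ) :
    (P.f i t).toReal ≤ 2 * diameter M :=
  ENNReal.toReal_le_of_le_ofReal (by linarith [h.diam_pos]) (h.cost_le i t ht)

lemma cost_ne_top (h : P.Admissible m ε η α) (ht : t ∈ Finset.Icc 1 P.T) (i : Fin ℓ) :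
    P.f i t ≠ ∞ := ne_top_of_le_ne_top ENNReal.ofReal_ne_top (h.cost_le i t ht)

lemma loss_nonneg (h : P.Admissible m ε η α) (e : ℕ → Fin ℓ) (t : ℕ) (i : Fin ℓ) :
    0 ≤ P.loss e t i := by
  have := h.diam_pos
  unfold Instance.loss
  split_ifs <;> positivity

lemma loss_le_one (h : P.Admissible m ε η α) (e : ℕ → Fin ℓ) (ht : t ∈ Finset.Icc 1 P.T)
    (i : Fin ℓ) : P.loss e t i ≤ 1 := by
  have := h.diam_pos
  unfold Instance.loss
  split_ifs
  · exact (div_le_one (by positivity)).2 (h.cost_toReal_le ht i)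
  · exact zero_le_one

lemma weights_pos (h : P.Admissible m ε η α) (β : ℕ → Bool) (e : ℕ → Fin ℓ) (t : ℕ)
    (i : Fin ℓ) : 0 < P.weights m η α β e t i := by
  induction t generalizing i with
  | zero => exact one_pos
  | succ t ih =>
    rw [Instance.weights]
    split_ifs
    · exact shareUpdate_pos h.η_nonneg h.α_pos.le ih (h.loss_nonneg e t) i
    · exact ih i

variable [NeZero ℓ]

lemma x_pos (h : P.Admissible m ε η α) (β : ℕ → Bool) (e : ℕ → Fin ℓ) (t : ℕ) (i : Fin ℓ) :
    0 < P.x m η α β e t i := normalized_pos (h.weights_pos β e t) i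

lemma x_mem_stdSimplex (h : P.Admissible m ε η α) (β : ℕ → Bool) (e : ℕ → Fin ℓ) (t : ℕ) :
    P.x m η α β e t ∈ stdSimplex ℝ (Fin ℓ) := normalized_mem_stdSimplex (h.weights_pos β e t)

lemma meanCost_nonneg (h : P.Admissible m ε η α) (s t : ℕ) : 0 ≤ P.meanCost m η α s t :=
  fun β e => Finset.sum_nonneg fun i _ => mul_nonneg (h.x_pos β e s i).le ENNReal.toReal_nonneg

lemma meanCost_le (h : P.Admissible m ε η α) (s : ℕ) (ht : t ∈ Finset.Icc 1 P.T) (β : ℕ → Bool)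
    (e : ℕ → Fin ℓ) : P.meanCost m η α s t β e ≤ 2 * diameter M := by
  calc P.meanCost m η α s t β e ≤ ∑ i, P.x m η α β e s i * (2 * diameter M) :=
        Finset.sum_le_sum fun i _ =>
          mul_le_mul_of_nonneg_left (h.cost_toReal_le ht i) (h.x_pos β e s i).le
    _ = 2 * diameter M := by rw [← Finset.sum_mul, (h.x_mem_stdSimplex β e s).2, one_mul]

lemma learnerLoss_nonneg (h : P.Admissible m ε η α) (t : ℕ) : 0 ≤ P.learnerLoss m η α t :=
  fun β e => Finset.sum_nonneg fun i _ => mul_nonneg (h.x_pos β e t i).le (h.loss_nonneg e t i)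

lemma meanCost_after_block (h : P.Admissible m ε η α) {j : ℕ} (hj : j + 1 ≤ m)
    (ht : s + m + (j + 1) ∈ Finset.Icc 1 P.T) :
    starts m s * P.meanCost m η α (s + m + (j + 1)) (s + m + (j + 1)) ≤
      (4 : ℝ) • (starts m s * P.meanCost m η α s (s + m + (j + 1))) +
        (8 * α * η * diameter M) • (explores m (s + m) * P.learnerLoss m η α (s + m)) := by
  intro β e
  rw [explores_add h.one_le]
  simp only [Pi.mul_apply, Pi.add_apply, Pi.smul_apply, smul_eq_mul]
  by_cases hs : phase m β s = 0 ∧ β s = true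
  · have hend : s + m ∈ Finset.Icc 1 P.T := by
      have := h.one_le
      rw [Finset.mem_Icc] at ht ⊢
      omega
    have hupdate := average_shareUpdate_le h.quarter_le_exp h.η_nonneg h.α_pos.le
      (h.weights_pos β e s) (h.loss_nonneg e (s + m)) (h.loss_le_one e hend)
      (fun i => ENNReal.toReal_nonneg) (h.cost_toReal_le ht)
    rw [starts, coinIndicator, if_pos hs]
    simp only [Instance.meanCost, Instance.learnerLoss, x_eq_normalized,
      weights_after_block h.one_le hs.1 hs.2 hj, weights_add_of_exploits hs.1 (le_refl m)]
    linarith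
  · simp [coinIndicator, hs]

end Admissible

end Instance

end Dynamics

section Expectations

variable {M : Type*} [MetricSpace M] {ℓ m s t : ℕ} [NeZero ℓ]

namespace Instance

/-- The expectation over the coins and the explored heuristics drawn for the instance `P`. -/
noncomputable abbrev coinExp (P : Instance M ℓ) (m : ℕ) (ε : ℝ) : CoinVar ℓ →ₗ[ℝ] ℝ :=
  MTS.coinExp P.T (P.T + m) ε

/-- The expected average cost at time `t` under the distribution of the learner. -/
noncomputable def expMean (P : Instance M ℓ) (m : ℕ) (ε η α : ℝ) (t : ℕ) : ℝ :=
  P.coinExp m ε (P.meanCost m η α t t)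

/-- The part of the expected average cost at time `t` which the learner has a chance to observe:
an exploration step at time `t` requires an exploitation step at time `t - m`. -/
noncomputable def expObservable (P : Instance M ℓ) (m : ℕ) (ε η α : ℝ) (t : ℕ) : ℝ :=
  P.coinExp m ε (exploits m (t - m) * P.meanCost m η α t t)

/-- The expected loss which the learner incurs at time `t`. -/
noncomputable def expLoss (P : Instance M ℓ) (m : ℕ) (ε η α : ℝ) (t : ℕ) : ℝ :=
  P.coinExp m ε (explores m t * P.learnerLoss m η α t)

/-- The expected total loss which the learner incurs. -/
noncomputable def totalLoss (P : Instance M ℓ) (m : ℕ) (ε η α : ℝ) : ℝ :=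
  ∑ t ∈ Finset.Icc 1 P.T, P.expLoss m ε η α t

namespace Admissible

variable {P : Instance M ℓ} {ε η α : ℝ} {φ φ' : CoinVar ℓ}

lemma coinExp_mono (h : P.Admissible m ε η α)
    (hφ : ∀ β e, β 0 = false → φ β e ≤ φ' β e) : P.coinExp m ε φ ≤ P.coinExp m ε φ' :=
  MTS.coinExp_mono h.ε_pos.le h.ε_le_one fun β e hβ => hφ β e (hβ 0 (.inl rfl))

lemma coinExp_nonneg (h : P.Admissible m ε η α) (hφ : 0 ≤ φ) : 0 ≤ P.coinExp m ε φ :=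
  MTS.coinExp_nonneg h.ε_pos.le h.ε_le_one hφ

lemma coinExp_eq_zero (h : P.Admissible m ε η α) (hφ : ∀ β e, β 0 = false → φ β e = 0) :
    P.coinExp m ε φ = 0 :=
  (MTS.coinExp_congr (φ' := 0) h.ε_pos.le h.ε_le_one fun β e hβ =>
    hφ β e (hβ 0 (.inl rfl))).trans (map_zero _)

lemma coinExp_indicator_mul_le (h : P.Admissible m ε η α) (p : (ℕ → Bool) → Prop)
    [DecidablePred p] (hφ : 0 ≤ φ) : P.coinExp m ε (coinIndicator p * φ) ≤ P.coinExp m ε φ :=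
  h.coinExp_mono fun β e _ => mul_le_of_le_one_left hφ (coinIndicator_le_one p) β e

lemma expMean_nonneg (h : P.Admissible m ε η α) (t : ℕ) : 0 ≤ P.expMean m ε η α t :=
  h.coinExp_nonneg (h.meanCost_nonneg t t)

lemma expMean_le (h : P.Admissible m ε η α) (ht : t ∈ Finset.Icc 1 P.T) :
    P.expMean m ε η α t ≤ 2 * diameter M :=
  (h.coinExp_mono fun β e _ => h.meanCost_le t ht β e).trans_eq (coinExp_const _)

lemma expObservable_nonneg (h : P.Admissible m ε η α) (t : ℕ) : 0 ≤ P.expObservable m ε η α t :=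
  h.coinExp_nonneg (mul_nonneg (coinIndicator_nonneg _) (h.meanCost_nonneg t t))

lemma expObservable_le_expMean (h : P.Admissible m ε η α) (t : ℕ) :
    P.expObservable m ε η α t ≤ P.expMean m ε η α t :=
  h.coinExp_indicator_mul_le _ (h.meanCost_nonneg t t)

lemma expLoss_nonneg (h : P.Admissible m ε η α) (t : ℕ) : 0 ≤ P.expLoss m ε η α t :=
  h.coinExp_nonneg (mul_nonneg (coinIndicator_nonneg _) (h.learnerLoss_nonneg t))

lemma expLoss_eq_zero (h : P.Admissible m ε η α) (ht : t ≤ m) : P.expLoss m ε η α t = 0 :=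
  h.coinExp_eq_zero fun β e hβ => by rw [Pi.mul_apply, Pi.mul_apply,
    explores_eq_zero h.one_le ht hβ, zero_mul]

lemma coinExp_starts_le (h : P.Admissible m ε η α) (hs : 1 ≤ s) (t : ℕ) :
    P.coinExp m ε (starts m s * P.meanCost m η α s t) ≤
      ε * P.coinExp m ε (exploits m s * P.meanCost m η α s t) := by
  refine le_of_eq_of_le (congrArg _ ?_) (coinExp_coin_le h.ε_pos.le h.ε_le_one hs
    ((dependsOnPast_exploits m s).mul (P.dependsOnPast_meanCost s t))
    (mul_nonneg (coinIndicator_nonneg _) (h.meanCost_nonneg s t)))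
  funext β e
  simp only [Pi.mul_apply, starts_eq_mul, mul_assoc]

lemma coinExp_starts_near (h : P.Admissible m ε η α) (hs : 1 ≤ s) {j : ℕ} (hj : j ≤ m) :
    P.coinExp m ε (starts m s * P.meanCost m η α (s + j) (s + j)) ≤
      ε * P.expMean m ε η α (s + j) := by
  rw [starts_mul_meanCost_add s hj]
  refine (h.coinExp_starts_le hs _).trans (mul_le_mul_of_nonneg_left ?_ h.ε_pos.le)
  rw [← exploits_mul_meanCost_add s hj]
  exact h.coinExp_indicator_mul_le _ (h.meanCost_nonneg _ _)

lemma coinExp_exploits_succ (h : P.Admissible m ε η α) (hs : 1 ≤ s) (hsT : s ≤ P.T) (t : ℕ) :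
    (1 - ε) * P.coinExp m ε (exploits m s * P.meanCost m η α s t) ≤
      P.coinExp m ε (exploits m (s + 1) * P.meanCost m η α (s + 1) t) := by
  have hcoin := coinExp_coin (N := P.T + m) (ε := ε) hs hsT
    ((dependsOnPast_exploits m s).mul (P.dependsOnPast_meanCost (m := m) (η := η) (α := α) s t))
    fun c => if c then 0 else 1
  simp only [if_true, Bool.false_eq_true, if_false, mul_zero, mul_one, zero_add] at hcoin
  rw [← hcoin, ← exploits_mul_meanCost_add s h.one_le]
  refine h.coinExp_mono fun β e _ => ?_
  by_cases hstay : phase m β s = 0 ∧ β s = false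
  · have hnext : phase m β (s + 1) = 0 :=
      phase_eq_zero_of_no_start hstay.1 fun i hi => by
        rw [Nat.lt_one_iff.1 hi, add_zero, hstay.2]
    simp [coinIndicator, hstay, hnext]
  · refine le_of_eq_of_le ?_ (mul_nonneg (coinIndicator_nonneg _) (h.meanCost_nonneg _ _) β e)
    by_cases hb : β s <;> simp_all [coinIndicator]

lemma coinExp_exploits_add (h : P.Admissible m ε η α) (hs : 1 ≤ s) {j : ℕ}
    (hsT : s + j ≤ P.T + 1) (t : ℕ) :
    (1 - ε) ^ j * P.coinExp m ε (exploits m s * P.meanCost m η α s t) ≤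
      P.coinExp m ε (exploits m (s + j) * P.meanCost m η α (s + j) t) := by
  induction j with
  | zero => simp
  | succ j ih =>
    refine le_trans ?_ (h.coinExp_exploits_succ (s := s + j) (by omega) (by omega) t)
    rw [pow_succ', mul_assoc]
    exact mul_le_mul_of_nonneg_left (ih (by omega)) (sub_nonneg.2 h.ε_le_one)

lemma coinExp_exploits_le_expObservable (h : P.Admissible m ε η α) (hs : 1 ≤ s) {j : ℕ}
    (hj : j ≤ m) (hjT : s + j ≤ P.T) :
    P.coinExp m ε (exploits m s * P.meanCost m η α s (s + m + j)) ≤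
      2 * P.expObservable m ε η α (s + m + j) := by
  have hobservable : P.expObservable m ε η α (s + m + j) =
      P.coinExp m ε (exploits m (s + j) * P.meanCost m η α (s + j) (s + m + j)) := by
    rw [expObservable, add_right_comm, Nat.add_sub_cancel,
      exploits_mul_meanCost_add _ le_rfl]
  have hadd := h.coinExp_exploits_add hs (j := j) (by omega) (s + m + j)
  have hhalf := mul_le_mul_of_nonneg_right (h.half_le_pow hj) (h.coinExp_nonneg
    (mul_nonneg (coinIndicator_nonneg fun β => phase m β s = 0)
      (h.meanCost_nonneg s (s + m + j))))
  linarith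

lemma coinExp_starts_far (h : P.Admissible m ε η α) (hs : 1 ≤ s) {j : ℕ} (hj : j + 1 ≤ m)
    (ht : s + m + (j + 1) ≤ P.T) :
    P.coinExp m ε (starts m s * P.meanCost m η α (s + m + (j + 1)) (s + m + (j + 1))) ≤
      8 * ε * P.expObservable m ε η α (s + m + (j + 1)) +
        8 * α * η * diameter M * P.expLoss m ε η α (s + m) := by
  calc _ ≤ 4 * P.coinExp m ε (starts m s * P.meanCost m η α s (s + m + (j + 1))) +
        8 * α * η * diameter M * P.expLoss m ε η α (s + m) := by
        refine (h.coinExp_mono fun β e _ =>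
          h.meanCost_after_block hj (Finset.mem_Icc.2 ⟨by omega, ht⟩) β e).trans_eq ?_
        rw [map_add, map_smul, map_smul]
        rfl
    _ ≤ 4 * (ε * (2 * P.expObservable m ε η α (s + m + (j + 1)))) +
        8 * α * η * diameter M * P.expLoss m ε η α (s + m) := by
        gcongr
        refine (h.coinExp_starts_le hs _).trans ?_
        exact mul_le_mul_of_nonneg_left
          (h.coinExp_exploits_le_expObservable hs hj (by omega)) h.ε_pos.le
    _ = _ := by ring

lemma coinExp_starts_zero (h : P.Admissible m ε η α) (φ : CoinVar ℓ) :
    P.coinExp m ε (starts m 0 * φ) = 0 :=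
  h.coinExp_eq_zero fun β e hβ => by rw [Pi.mul_apply, Pi.mul_apply, starts_zero hβ, zero_mul]

lemma coinExp_starts_sub_far (h : P.Admissible m ε η α) (ht : t ≤ P.T) {j : ℕ}
    (hj : j + 1 ≤ m) :
    P.coinExp m ε (starts m (t - (m + (j + 1))) * P.meanCost m η α t t) ≤
      8 * ε * P.expObservable m ε η α t +
        8 * α * η * diameter M * P.expLoss m ε η α (t - (j + 1)) := by
  rcases le_or_gt t (m + (j + 1)) with hearly | hlate
  · rw [Nat.sub_eq_zero_of_le hearly, h.coinExp_starts_zero]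
    have := h.expObservable_nonneg t
    have := h.expLoss_nonneg (t - (j + 1))
    have := h.ε_pos
    have := h.α_pos
    have := h.η_nonneg
    have := h.diam_pos
    positivity
  · obtain ⟨s, hs, rfl⟩ : ∃ s, 1 ≤ s ∧ t = s + m + (j + 1) :=
      ⟨t - (m + (j + 1)), by omega, by omega⟩
    rw [add_assoc, Nat.add_sub_cancel, ← add_assoc, Nat.add_sub_cancel]
    exact h.coinExp_starts_far hs hj ht

lemma coinExp_starts_sub_near (h : P.Admissible m ε η α) (t : ℕ) {j : ℕ} (hj : j ≤ m) :
    P.coinExp m ε (starts m (t - j) * P.meanCost m η α t t) ≤ ε * P.expMean m ε η α t := by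
  rcases le_or_gt t j with hearly | hlate
  · rw [Nat.sub_eq_zero_of_le hearly, h.coinExp_starts_zero]
    exact mul_nonneg h.ε_pos.le (h.expMean_nonneg t)
  · obtain ⟨s, hs, rfl⟩ : ∃ s, 1 ≤ s ∧ t = s + j := ⟨t - j, by omega, by omega⟩
    rw [Nat.add_sub_cancel]
    exact h.coinExp_starts_near hs hj

lemma expMean_le_expObservable (h : P.Admissible m ε η α) (ht : t ≤ P.T) :
    P.expMean m ε η α t ≤ (1 + 8 * m * ε) * P.expObservable m ε η α t +
      8 * α * η * diameter M * ∑ j ∈ Finset.range m, P.expLoss m ε η α (t - (j + 1)) := by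
  calc P.expMean m ε η α t
      ≤ P.coinExp m ε (exploits m (t - m) * P.meanCost m η α t t +
          ∑ j ∈ Finset.range m, starts m (t - (m + (j + 1))) * P.meanCost m η α t t) := by
        refine h.coinExp_mono fun β e _ => ?_
        have hone := mul_le_mul_of_nonneg_right
          (one_le_exploits_add_sum_starts h.one_le (t - m) β e) (h.meanCost_nonneg t t β e)
        simp only [Nat.sub_sub, one_mul, add_mul, Finset.sum_mul] at hone
        simpa only [Pi.add_apply, Pi.mul_apply, Finset.sum_apply] using hone
    _ ≤ P.expObservable m ε η α t + ∑ j ∈ Finset.range m, (8 * ε * P.expObservable m ε η α t +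
          8 * α * η * diameter M * P.expLoss m ε η α (t - (j + 1))) := by
        rw [map_add, map_sum]
        exact add_le_add le_rfl (Finset.sum_le_sum fun j hj =>
          h.coinExp_starts_sub_far ht (Finset.mem_range.1 hj))
    _ = _ := by
        simp only [Finset.sum_add_distrib, Finset.sum_const, Finset.card_range, nsmul_eq_mul,
          ← Finset.mul_sum]
        ring

lemma coinExp_unsettled_le (h : P.Admissible m ε η α) (ht : t ∈ Finset.Icc 1 P.T) :
    P.coinExp m ε (fun β e => unsettled m β t * P.meanCost m η α t t β e) ≤
      (if t < m then 2 * diameter M else 0) + 9 * m * ε * P.expMean m ε η α t +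
        8 * α * η * diameter M * ∑ j ∈ Finset.range m, P.expLoss m ε η α (t - (j + 1)) := by
  calc _ ≤ P.coinExp m ε ((fun _ _ => if t < m then 2 * diameter M else 0) +
          ∑ j ∈ Finset.range (m + m), starts m (t - (j + 1)) * P.meanCost m η α t t) := by
        refine h.coinExp_mono fun β e _ => ?_
        have hstarts := mul_le_mul_of_nonneg_right (unsettled_le_sum_starts h.one_le t β e)
          (h.meanCost_nonneg t t β e)
        refine hstarts.trans ?_
        simp only [Pi.add_apply, Pi.mul_apply, Finset.sum_apply, add_mul, Finset.sum_mul,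
          ite_mul, one_mul, zero_mul]
        refine add_le_add_left ?_ _
        split_ifs
        exacts [h.meanCost_le t ht β e, le_rfl]
    _ ≤ (if t < m then 2 * diameter M else 0) + (∑ _j ∈ Finset.range m, ε * P.expMean m ε η α t +
          ∑ j ∈ Finset.range m, (8 * ε * P.expMean m ε η α t +
            8 * α * η * diameter M * P.expLoss m ε η α (t - (j + 1)))) := by
        rw [map_add, coinExp_const, map_sum, Finset.sum_range_add]
        refine add_le_add le_rfl (add_le_add (Finset.sum_le_sum fun j hj =>
          h.coinExp_starts_sub_near t (Finset.mem_range.1 hj)) (Finset.sum_le_sum fun j hj => ?_))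
        refine (h.coinExp_starts_sub_far (Finset.mem_Icc.1 ht).2 (Finset.mem_range.1 hj)).trans ?_
        have := h.ε_pos
        gcongr
        exact h.expObservable_le_expMean t
    _ = _ := by
        simp only [Finset.sum_add_distrib, Finset.sum_const, Finset.card_range, nsmul_eq_mul,
          ← Finset.mul_sum]
        ring

lemma coinExp_starts_explored (h : P.Admissible m ε η α) (hs : 1 ≤ s) (hsT : s + m ≤ P.T)
    {φ : Fin ℓ → CoinVar ℓ} (hφ : ∀ i, DependsOnPast s (φ i)) :
    P.coinExp m ε (fun β e => starts m s β e * φ (e (s + m)) β e) =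
      ε / ℓ * P.coinExp m ε (exploits m s * ∑ i, φ i) := by
  have hm := h.one_le
  have hstarts (i : Fin ℓ) :
      P.coinExp m ε (starts m s * φ i) = ε * P.coinExp m ε (exploits m s * φ i) := by
    have hcoin := coinExp_coin (N := P.T + m) (ε := ε) hs (by omega : s ≤ P.T)
      ((dependsOnPast_exploits m s).mul (hφ i)) fun c => if c then 1 else 0
    simp only [if_true, Bool.false_eq_true, if_false, mul_zero, mul_one, add_zero] at hcoin
    rw [← hcoin]
    congr 1
    funext β e
    simp only [Pi.mul_apply, starts_eq_mul, mul_assoc]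
  have hindep (i : Fin ℓ) (β : ℕ → Bool) (e : ℕ → Fin ℓ) (j : Fin ℓ) :
      φ i β (Function.update e (s + m) j) = φ i β e :=
    hφ i β β _ e (fun _ _ => rfl) fun _ ht => Function.update_of_ne (by omega) _ _
  have hexplored := coinExp_explored (T := P.T) (N := P.T + m) (ε := ε) (s := s + m)
    (Ψ := fun i => starts m s * φ i) (by omega) (by omega)
    fun i β e j => congrArg (starts m s β e * ·) (hindep i β e j)
  refine hexplored.trans ?_
  rw [Finset.sum_congr rfl fun i _ => hstarts i, ← Finset.mul_sum, ← map_sum, ← Finset.mul_sum]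
  ring

lemma expLoss_eq (h : P.Admissible m ε η α) (ht : m < t) (htT : t ≤ P.T) :
    P.expLoss m ε η α t = ε / (2 * diameter M * ℓ) * P.expObservable m ε η α t := by
  obtain ⟨s, hs, rfl⟩ : ∃ s, 1 ≤ s ∧ t = s + m := ⟨t - m, by omega, by omega⟩
  set φ : Fin ℓ → CoinVar ℓ := fun i β e =>
    P.x m η α β e s i * ((P.f i (s + m)).toReal / (2 * diameter M))
  have hφ (i : Fin ℓ) : DependsOnPast s (φ i) :=
    (P.dependsOnPast_x s i).mul fun _ _ _ _ _ _ => rfl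
  have hsum : ∑ i, φ i = (1 / (2 * diameter M)) • P.meanCost m η α s (s + m) := by
    funext β e
    simp only [φ, Finset.sum_apply, Pi.smul_apply, smul_eq_mul, meanCost, Finset.mul_sum]
    exact Finset.sum_congr rfl fun i _ => by ring
  have hexplored : explores m (s + m) * P.learnerLoss m η α (s + m) =
      fun β e => starts m s β e * φ (e (s + m)) β e := by
    rw [explores_add h.one_le]
    funext β e
    simp only [Pi.mul_apply, learnerLoss_eq, coinIndicator, φ]
    split_ifs with hstart
    · rw [x_eq_normalized, weights_add_of_exploits hstart.1 le_rfl, x_eq_normalized]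
    · simp only [zero_mul]
  rw [expLoss, hexplored, h.coinExp_starts_explored hs htT hφ, hsum, mul_smul_comm, map_smul,
    smul_eq_mul, expObservable, Nat.add_sub_cancel, exploits_mul_meanCost_add s le_rfl]
  ring

lemma coinExp_explores_mul_loss_le (h : P.Admissible m ε η α) (ht : t ≤ P.T) (i : Fin ℓ) :
    P.coinExp m ε (fun β e => explores m t β e * P.loss e t i) ≤
      ε / (2 * diameter M * ℓ) * (P.f i t).toReal := by
  have hD := h.diam_pos
  have hε := h.ε_pos
  rcases le_or_gt t m with htm | htm
  · rw [h.coinExp_eq_zero fun β e hβ => by rw [explores_eq_zero h.one_le htm hβ, zero_mul]]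
    positivity
  · obtain ⟨s, hs, rfl⟩ : ∃ s, 1 ≤ s ∧ t = s + m := ⟨t - m, by omega, by omega⟩
    set a : ℝ := (P.f i (s + m)).toReal / (2 * diameter M)
    have ha : 0 ≤ a := by positivity
    have hexplored := h.coinExp_starts_explored hs ht (φ := fun j _ _ => if i = j then a else 0)
      fun j _ _ _ _ _ _ => rfl
    have hsum : ∑ j, (fun _ _ => if i = j then a else 0 : CoinVar ℓ) = fun _ _ => a := by
      funext β e
      simp
    rw [hsum] at hexplored
    rw [explores_add h.one_le]
    calc _ = ε / ℓ * P.coinExp m ε (exploits m s * fun _ _ => a) := hexplored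
      _ ≤ ε / ℓ * a := by
          gcongr
          exact (h.coinExp_indicator_mul_le _ fun _ _ => ha).trans_eq (coinExp_const a)
      _ = _ := by
          simp only [a]
          field_simp

end Admissible

end Instance

end Expectations

section Cost

variable {M : Type*} [MetricSpace M] {ℓ m t : ℕ} {ε η α : ℝ}

namespace Instance

/-- The cost of the exploited heuristics `r` including switches, in which each step is weighted
with the length of the run of unsettled steps which it starts. -/
noncomputable def weightedCost (P : Instance M ℓ) (m : ℕ) (β : ℕ → Bool) (r : ℕ → Fin ℓ) : ℝ :=
  ∑ t ∈ Finset.Icc 1 P.T, (1 + 2 * (unsettledRun m β P.T t : ℝ)) *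
    ((P.f (r t) t).toReal + diameter M * if r (t - 1) = r t then 0 else 1)

/-- A bound on the expected cost of the exploited heuristic at time `t`, including switches, given
the coins and the explored heuristics. -/
noncomputable def stepCost (P : Instance M ℓ) (m : ℕ) (η α : ℝ) (t : ℕ) : CoinVar ℓ :=
  P.meanCost m η α t t +
    (diameter M * η) • (explores m (t - 1) * P.learnerLoss m η α (t - 1))

lemma weightedCost_nonneg (P : Instance M ℓ) (m : ℕ) (β : ℕ → Bool) (r : ℕ → Fin ℓ) :
    0 ≤ P.weightedCost m β r := by
  have : 0 ≤ diameter M := Metric.diam_nonneg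
  exact Finset.sum_nonneg fun t _ => by positivity

lemma dependsOnPast_learnerLoss (P : Instance M ℓ) (t : ℕ) :
    DependsOnPast (t + 1) (P.learnerLoss m η α t) := fun β β' e e' hβ he => by
  have hweights : P.weights m η α β e t = P.weights m η α β' e' t :=
    P.weights_congr (fun s hs => hβ s (by omega)) fun s hs => he s (by omega)
  simp only [learnerLoss, Instance.x, hweights, P.loss_congr (he t t.lt_succ_self)]

lemma dependsOnPast_stepCost (P : Instance M ℓ) (ht : 1 ≤ t) :
    DependsOnPast t (P.stepCost m η α t) := by
  obtain ⟨u, rfl⟩ : ∃ u, t = u + 1 := ⟨t - 1, by omega⟩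
  exact (P.dependsOnPast_meanCost _ _).add ((((dependsOnPast_explores m u).mono
    u.le_succ).mul (P.dependsOnPast_learnerLoss u)).smul _)

namespace Admissible

variable {P : Instance M ℓ} {τ : (Fin ℓ → ℝ) → (Fin ℓ → ℝ) → Fin ℓ → Fin ℓ → ℝ}
  {greedy : ℕ → M → M}

lemma pathCost_algState_le_weightedCost [BoundedSpace M] (h : P.Admissible m ε η α)
    (hg : P.IsGreedy greedy) {β : ℕ → Bool} {e r : ℕ → Fin ℓ}
    (hr : ∀ t, t + 1 ≤ P.T → phase m β t ≠ m → r (t + 1) = r t) :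
    P.pathCost (P.algState m greedy β e r) ≤ ENNReal.ofReal (P.weightedCost m β r) := by
  have hD := h.diam_pos
  refine (P.pathCost_algState_le hg h.two_le hr).trans ?_
  rw [weightedCost, ENNReal.ofReal_sum_of_nonneg fun t _ => by positivity]
  refine Finset.sum_le_sum fun t ht => ?_
  rw [ENNReal.ofReal_mul (by positivity), ENNReal.ofReal_add zero_le_one (by positivity),
    ENNReal.ofReal_one, ENNReal.ofReal_mul zero_le_two, ENNReal.ofReal_natCast,
    ENNReal.ofReal_ofNat, ENNReal.ofReal_add ENNReal.toReal_nonneg (by positivity),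
    ENNReal.ofReal_toReal (h.cost_ne_top ht _)]
  refine mul_le_mul_right ((P.exploited_cost_le r t).trans_eq ?_) _
  split_ifs <;> simp

variable [NeZero ℓ]

lemma movement_x_le (h : P.Admissible m ε η α) (t : ℕ) (β : ℕ → Bool) (e : ℕ → Fin ℓ) :
    ∑ i, max 0 (P.x m η α β e t i - P.x m η α β e (t + 1) i) ≤
      η * (explores m t β e * P.learnerLoss m η α t β e) := by
  rw [x_eq_normalized, x_eq_normalized, weights_succ]
  refine (movement_normalized_shareUpdate_le h.η_nonneg h.α_pos.le (by linarith [h.α_le])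
    (h.weights_pos β e t) fun i =>
      mul_nonneg (coinIndicator_nonneg _ β e) (h.loss_nonneg e t i)).trans_eq ?_
  simp only [learnerLoss, x_eq_normalized, Finset.mul_sum, mul_left_comm]

lemma stepCost_nonneg (h : P.Admissible m ε η α) (t : ℕ) : 0 ≤ P.stepCost m η α t :=
  add_nonneg (h.meanCost_nonneg t t) (smul_nonneg (mul_nonneg h.diam_pos.le h.η_nonneg)
    (mul_nonneg (coinIndicator_nonneg _) (h.learnerLoss_nonneg _)))

lemma chainExp_weightedCost_le (h : P.Admissible m ε η α) (hτ : IsOptimalPlan τ) (β : ℕ → Bool)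
    (e : ℕ → Fin ℓ) :
    chainExp (P.x m η α β e 0)
      (fun t => roundProb τ (P.x m η α β e (t - 1)) (P.x m η α β e t)) P.T
      (P.weightedCost m β) ≤
      ∑ t ∈ Finset.Icc 1 P.T, (1 + 2 * (unsettledRun m β P.T t : ℝ)) *
        P.stepCost m η α t β e := by
  set x := P.x m η α β e
  have hpos := h.x_pos β e
  have hmem := h.x_mem_stdSimplex β e
  have hsum : P.weightedCost m β = ∑ t ∈ Finset.Icc 1 P.T,
      (1 + 2 * (unsettledRun m β P.T t : ℝ)) • fun r : ℕ → Fin ℓ =>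
        (P.f (r t) t).toReal + diameter M * if r (t - 1) = r t then 0 else 1 := by
    funext r
    simp only [weightedCost, Finset.sum_apply, Pi.smul_apply, smul_eq_mul]
  rw [hsum, map_sum]
  refine Finset.sum_le_sum fun t ht => ?_
  rw [map_smul, smul_eq_mul]
  refine mul_le_mul_of_nonneg_left ?_ (by positivity)
  obtain ⟨u, rfl⟩ : ∃ u, t = u + 1 := ⟨t - 1, by have := (Finset.mem_Icc.1 ht).1; omega⟩
  have htransition := chainExp_transition (x := x)
    (K := fun t => roundProb τ (x (t - 1)) (x t))
    (fun t j => sum_mul_roundProb hτ (hmem t) (hmem (t + 1)) (hpos t) j)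
    (fun t i => sum_roundProb hτ (hmem t) (hmem (t + 1)) (hpos t i)) (Finset.mem_Icc.1 ht).2
    fun i j => (P.f j (u + 1)).toReal + diameter M * if i = j then 0 else 1
  refine htransition.trans_le ?_
  rw [Nat.add_sub_cancel,
    sum_mul_roundProb_cost hτ (hmem u) (hmem (u + 1)) (hpos u) fun j => (P.f j (u + 1)).toReal]
  simp only [stepCost, Pi.add_apply, Pi.smul_apply, Pi.mul_apply, smul_eq_mul,
    Nat.add_sub_cancel, mul_assoc]
  exact add_le_add le_rfl (mul_le_mul_of_nonneg_left (h.movement_x_le u β e) h.diam_pos.le)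

lemma prob_nonneg (h : P.Admissible m ε η α) (hτ : IsOptimalPlan τ) (ω : Outcome P.T m ℓ) :
    0 ≤ P.prob m ε η α τ ω := by
  have hε := h.ε_pos
  have hε1 := h.ε_le_one
  refine mul_nonneg (mul_nonneg (Finset.prod_nonneg fun t _ => ?_) (by positivity))
    (mul_nonneg (by positivity) (Finset.prod_nonneg fun t _ => roundProb_nonneg hτ
      (h.x_mem_stdSimplex _ _ _) (h.x_mem_stdSimplex _ _ _) _ _))
  split_ifs <;> linarith

end Admissible

lemma exploited_eq_of_prob_ne_zero [NeZero ℓ] {P : Instance M ℓ}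
    {τ : (Fin ℓ → ℝ) → (Fin ℓ → ℝ) → Fin ℓ → Fin ℓ → ℝ} {ω : Outcome P.T m ℓ}
    (hω : P.prob m ε η α τ ω ≠ 0) (ht : t + 1 ≤ P.T) (hphase : phase m ω.β t ≠ m) :
    ω.i (t + 1) = ω.i t := by
  have hround := Finset.prod_ne_zero_iff.1 (right_ne_zero_of_mul (right_ne_zero_of_mul hω))
    (t + 1) (Finset.mem_Icc.2 ⟨by omega, ht⟩)
  have hx : P.x m η α ω.β ω.e (t + 1) = P.x m η α ω.β ω.e t := by
    simp only [x_eq_normalized, Instance.weights, if_neg hphase]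
  rw [Nat.add_sub_cancel, hx, roundProb_self] at hround
  exact of_not_not fun hne => hround (if_neg hne)

lemma sum_prob_mul [NeZero ℓ] (P : Instance M ℓ) (m : ℕ) (ε η α : ℝ)
    (τ : (Fin ℓ → ℝ) → (Fin ℓ → ℝ) → Fin ℓ → Fin ℓ → ℝ)
    (g : (ℕ → Bool) → (ℕ → Fin ℓ) → (ℕ → Fin ℓ) → ℝ) :
    ∑ ω : Outcome P.T m ℓ, P.prob m ε η α τ ω * g ω.β ω.e ω.i =
      P.coinExp m ε fun β e => chainExp (P.x m η α β e 0)
        (fun t => roundProb τ (P.x m η α β e (t - 1)) (P.x m η α β e t)) P.T (g β e) := by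
  have hcoins (b : Fin P.T → Bool) :
      ∏ t ∈ Finset.Icc 1 P.T, (if extendDraws b t then ε else 1 - ε) =
        ∏ i, if b i then ε else 1 - ε := by
    rw [← Finset.Ico_add_one_right_eq_Icc, Finset.prod_Ico_eq_prod_range, Nat.add_sub_cancel,
      Finset.prod_range]
    refine Finset.prod_congr rfl fun i _ => ?_
    have hi : 1 ≤ 1 + (i : ℕ) ∧ 1 + (i : ℕ) ≤ P.T := ⟨by omega, by omega⟩
    simp only [extendDraws, dif_pos hi, Nat.add_sub_cancel_left, Fin.eta]
  have hexplored : ∏ _i : Fin (P.T + m), 1 / (ℓ : ℝ) =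
      ∏ _t ∈ Finset.Icc 1 (P.T + m), 1 / (ℓ : ℝ) := by simp
  have hinitial (β : ℕ → Bool) (e : ℕ → Fin ℓ) (i : Fin ℓ) : P.x m η α β e 0 i = 1 / ℓ := by
    simp [Instance.x, Instance.weights]
  simp only [coinExp, coinExp_apply, drawExp_apply, chainExp_apply, hinitial, hexplored, ← hcoins,
    Fintype.sum_prod_type, Finset.mul_sum]
  refine Finset.sum_congr rfl fun b _ => Finset.sum_congr rfl fun v _ =>
    Finset.sum_congr rfl fun r _ => ?_
  rw [← mul_assoc, ← mul_assoc]
  rfl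

namespace Admissible

variable [NeZero ℓ] {P : Instance M ℓ} {τ : (Fin ℓ → ℝ) → (Fin ℓ → ℝ) → Fin ℓ → Fin ℓ → ℝ}
  {greedy : ℕ → M → M}

lemma prob_mul_pathCost_le [BoundedSpace M] (h : P.Admissible m ε η α) (hτ : IsOptimalPlan τ)
    (hg : P.IsGreedy greedy) (ω : Outcome P.T m ℓ) :
    ENNReal.ofReal (P.prob m ε η α τ ω) * P.pathCost (P.algState m greedy ω.β ω.e ω.i) ≤
      ENNReal.ofReal (P.prob m ε η α τ ω * P.weightedCost m ω.β ω.i) := by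
  by_cases hω : P.prob m ε η α τ ω = 0
  · simp [hω]
  · rw [ENNReal.ofReal_mul (h.prob_nonneg hτ ω)]
    exact mul_le_mul_right (h.pathCost_algState_le_weightedCost hg fun t ht hphase =>
      exploited_eq_of_prob_ne_zero hω ht hphase) _

lemma expectedCost_le [BoundedSpace M] (h : P.Admissible m ε η α) (hτ : IsOptimalPlan τ)
    (hg : P.IsGreedy greedy) :
    P.expectedCost m ε η α τ greedy ≤ ENNReal.ofReal (∑ t ∈ Finset.Icc 1 P.T,
      P.coinExp m ε fun β e => (1 + 2 * (unsettledRun m β P.T t : ℝ)) *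
        P.stepCost m η α t β e) := by
  refine (Finset.sum_le_sum fun ω _ => h.prob_mul_pathCost_le hτ hg ω).trans ?_
  rw [← ENNReal.ofReal_sum_of_nonneg fun ω _ =>
    mul_nonneg (h.prob_nonneg hτ ω) (P.weightedCost_nonneg _ _ _)]
  refine ENNReal.ofReal_le_ofReal ?_
  rw [P.sum_prob_mul m ε η α τ fun β _ r => P.weightedCost m β r, ← map_sum]
  refine h.coinExp_mono fun β e _ => (h.chainExp_weightedCost_le hτ β e).trans_eq ?_
  simp only [Finset.sum_apply]

lemma coinExp_unsettled_mul_stepCost_le (h : P.Admissible m ε η α) (t : ℕ) :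
    P.coinExp m ε (fun β e => unsettled m β t * P.stepCost m η α t β e) ≤
      P.coinExp m ε (fun β e => unsettled m β t * P.meanCost m η α t t β e) +
        diameter M * η * P.expLoss m ε η α (t - 1) := by
  have hD := h.diam_pos
  have hη := h.η_nonneg
  rw [expLoss, ← smul_eq_mul, ← map_smul, ← map_add]
  refine h.coinExp_mono fun β e _ => ?_
  simp only [stepCost, Pi.add_apply, Pi.smul_apply, mul_add]
  refine add_le_add le_rfl (mul_le_of_le_one_left (mul_nonneg (by positivity)
    (mul_nonneg (coinIndicator_nonneg _) (h.learnerLoss_nonneg _) β e)) ?_)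
  exact_mod_cast unsettled_le_one m β t

lemma coinExp_weighted_stepCost_le (h : P.Admissible m ε η α) (ht : t ∈ Finset.Icc 1 P.T) :
    (P.coinExp m ε fun β e => (1 + 2 * (unsettledRun m β P.T t : ℝ)) *
        P.stepCost m η α t β e) ≤
      (1 + 144 * m ^ 2 * ε) * P.expMean m ε η α t +
      (1 + 16 * m) * (diameter M * η * P.expLoss m ε η α (t - 1)) +
      16 * m * (if t < m then 2 * diameter M else 0) +
      128 * m * α * η * diameter M * ∑ j ∈ Finset.range m, P.expLoss m ε η α (t - (j + 1)) := by
  have ht1 := (Finset.mem_Icc.1 ht).1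
  have hsplit : (fun β e => (1 + 2 * (unsettledRun m β P.T t : ℝ)) * P.stepCost m η α t β e) =
      P.stepCost m η α t +
        (2 : ℝ) • fun β e => (unsettledRun m β P.T t : ℝ) * P.stepCost m η α t β e := by
    funext β e
    simp only [Pi.add_apply, Pi.smul_apply, smul_eq_mul]
    ring
  have hstep : P.coinExp m ε (P.stepCost m η α t) =
      P.expMean m ε η α t + diameter M * η * P.expLoss m ε η α (t - 1) := by
    rw [stepCost, map_add, map_smul]
    rfl
  have hrun := coinExp_unsettledRun_le (T := P.T) (N := P.T + m) h.one_le h.ε_pos.le h.ε_le_one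
    h.mε_le ht1 (P.dependsOnPast_stepCost ht1) (h.stepCost_nonneg t)
  have hunsettled := mul_le_mul_of_nonneg_left ((h.coinExp_unsettled_mul_stepCost_le t).trans
    (add_le_add (h.coinExp_unsettled_le ht) le_rfl)) (by positivity : (0 : ℝ) ≤ 8 * m)
  rw [hsplit, map_add, map_smul, smul_eq_mul, hstep]
  linarith [hrun.trans hunsettled]

lemma share_loss_le (h : P.Admissible m ε η α) (i : ℕ → Fin ℓ) (β : ℕ → Bool)
    (e : ℕ → Fin ℓ) :
    (1 - α) * (1 - Real.exp (-η)) *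
        ∑ t ∈ Finset.Icc 1 P.T, explores m t β e * P.learnerLoss m η α t β e ≤
      η * ∑ t ∈ Finset.Icc 1 P.T, explores m t β e * P.loss e t (i t) +
        (switches i P.T + 1) * Real.log (2 * ℓ / α) := by
  have hinitial : P.weights m η α β e 1 = 1 := by
    have := h.two_le
    rw [Instance.weights, if_neg (by simp only [phase]; omega), Instance.weights]
    rfl
  refine le_of_eq_of_le ?_ (share_regret h.η_nonneg h.α_pos (by linarith [h.α_le])
    (P.weights_succ m η α β e) (h.weights_pos β e) hinitial
    (fun t j => mul_nonneg (coinIndicator_nonneg _ β e) (h.loss_nonneg e t j))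
    (fun t ht j => ?_) i)
  · simp only [learnerLoss, x_eq_normalized, Finset.mul_sum, mul_left_comm]
  · exact mul_le_one₀ (coinIndicator_le_one _ β e) (h.loss_nonneg e t j) (h.loss_le_one e ht j)

lemma totalLoss_le (h : P.Admissible m ε η α) (i : ℕ → Fin ℓ) :
    (1 - α) * (1 - Real.exp (-η)) * P.totalLoss m ε η α ≤
      η * (ε / (2 * diameter M * ℓ) * ∑ t ∈ Finset.Icc 1 P.T, (P.f (i t) t).toReal) +
        (switches i P.T + 1) * Real.log (2 * ℓ / α) := by
  have hmean : P.coinExp m ε (((1 - α) * (1 - Real.exp (-η))) •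
        ∑ t ∈ Finset.Icc 1 P.T, explores m t * P.learnerLoss m η α t) ≤
      P.coinExp m ε (η • (∑ t ∈ Finset.Icc 1 P.T, fun β e =>
          explores m t β e * P.loss e t (i t)) +
        fun _ _ => (switches i P.T + 1) * Real.log (2 * ℓ / α)) :=
    h.coinExp_mono fun β e _ => by
      simpa only [Pi.add_apply, Pi.smul_apply, Pi.mul_apply, smul_eq_mul, Finset.sum_apply]
        using h.share_loss_le i β e
  rw [map_add, map_smul, map_smul, map_sum, map_sum, coinExp_const] at hmean
  refine hmean.trans (add_le_add (mul_le_mul_of_nonneg_left ?_ h.η_nonneg) le_rfl)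
  rw [Finset.mul_sum]
  exact Finset.sum_le_sum fun t ht =>
    h.coinExp_explores_mul_loss_le (Finset.mem_Icc.1 ht).2 (i t)

end Admissible

end Instance

end Cost

section Total

lemma sum_Icc_sub_le {F : ℕ → ℝ} (hF : ∀ t, 0 ≤ F t) (h0 : F 0 = 0) (T j : ℕ) :
    ∑ t ∈ Finset.Icc 1 T, F (t - j) ≤ ∑ t ∈ Finset.Icc 1 T, F t := by
  induction j generalizing F with
  | zero => simp
  | succ j ih =>
    have hshift : ∑ t ∈ Finset.Icc 1 T, F (t - 1) + F T = ∑ t ∈ Finset.Icc 1 T, F t := by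
      clear ih
      induction T with
      | zero => simp [h0]
      | succ T ih =>
        rw [Finset.sum_Icc_succ_top (by omega), Finset.sum_Icc_succ_top (by omega),
          Nat.add_sub_cancel, ih]
    have hle := ih (F := fun t => F (t - 1)) (fun t => hF _) h0
    simp only [Nat.sub_sub] at hle
    linarith [hF T]

lemma sum_Icc_ite_le {c : ℝ} (hc : 0 ≤ c) (T n : ℕ) :
    ∑ t ∈ Finset.Icc 1 T, (if t ≤ n then c else 0) ≤ n * c := by
  rw [← Finset.sum_filter, Finset.sum_const, nsmul_eq_mul]
  gcongr
  calc _ ≤ (Finset.Icc 1 n).card := Finset.card_le_card fun t ht => by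
        simp only [Finset.mem_filter, Finset.mem_Icc] at ht ⊢
        omega
    _ = n := by simp

variable {M : Type*} [MetricSpace M] {ℓ m : ℕ} [NeZero ℓ]

namespace Instance

/-- The expected cost which the learner has a chance to observe. There are no exploration steps up
to time `m`. -/
noncomputable def observableCost (P : Instance M ℓ) (m : ℕ) (ε η α : ℝ) : ℝ :=
  ∑ t ∈ Finset.Icc 1 P.T, if t ≤ m then 0 else P.expObservable m ε η α t

namespace Admissible

variable {P : Instance M ℓ} {ε η α : ℝ}

lemma observableCost_nonneg (h : P.Admissible m ε η α) : 0 ≤ P.observableCost m ε η α :=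
  Finset.sum_nonneg fun t _ => by
    split_ifs
    exacts [le_rfl, h.expObservable_nonneg t]

lemma totalLoss_eq (h : P.Admissible m ε η α) :
    P.totalLoss m ε η α = ε / (2 * diameter M * ℓ) * P.observableCost m ε η α := by
  rw [totalLoss, observableCost, Finset.mul_sum]
  refine Finset.sum_congr rfl fun t ht => ?_
  split_ifs with htm
  · rw [h.expLoss_eq_zero htm, mul_zero]
  · exact h.expLoss_eq (not_le.1 htm) (Finset.mem_Icc.1 ht).2

lemma sum_expLoss_sub_le (h : P.Admissible m ε η α) (j : ℕ) :
    ∑ t ∈ Finset.Icc 1 P.T, P.expLoss m ε η α (t - j) ≤ P.totalLoss m ε η α :=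
  sum_Icc_sub_le h.expLoss_nonneg (h.expLoss_eq_zero (Nat.zero_le _)) _ _

lemma sum_sum_expLoss_le (h : P.Admissible m ε η α) :
    ∑ t ∈ Finset.Icc 1 P.T, ∑ j ∈ Finset.range m, P.expLoss m ε η α (t - (j + 1)) ≤
      m * P.totalLoss m ε η α := by
  rw [Finset.sum_comm]
  refine (Finset.sum_le_sum fun j _ => h.sum_expLoss_sub_le (j + 1)).trans_eq ?_
  simp

lemma sum_expMean_le (h : P.Admissible m ε η α) :
    ∑ t ∈ Finset.Icc 1 P.T, P.expMean m ε η α t ≤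
      2 * diameter M * m + (1 + 8 * m * ε) * P.observableCost m ε η α +
        8 * α * η * diameter M * (m * P.totalLoss m ε η α) := by
  have hD := h.diam_pos
  have hcoeff : 0 ≤ 8 * α * η * diameter M := by
    have := h.α_pos
    have := h.η_nonneg
    positivity
  have hstep (t : ℕ) (ht : t ∈ Finset.Icc 1 P.T) : P.expMean m ε η α t ≤
      (if t ≤ m then 2 * diameter M else 0) +
        (1 + 8 * m * ε) * (if t ≤ m then 0 else P.expObservable m ε η α t) +
        8 * α * η * diameter M * ∑ j ∈ Finset.range m, P.expLoss m ε η α (t - (j + 1)) := by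
    split_ifs
    · rw [mul_zero, add_zero]
      exact (h.expMean_le ht).trans <| le_add_of_nonneg_right <|
        mul_nonneg hcoeff (Finset.sum_nonneg fun j _ => h.expLoss_nonneg _)
    · rw [zero_add]
      exact h.expMean_le_expObservable (Finset.mem_Icc.1 ht).2
  have hearly := sum_Icc_ite_le (by positivity : 0 ≤ 2 * diameter M) P.T m
  have hshare := mul_le_mul_of_nonneg_left h.sum_sum_expLoss_le hcoeff
  refine (Finset.sum_le_sum hstep).trans ?_
  rw [Finset.sum_add_distrib, Finset.sum_add_distrib, ← Finset.mul_sum, ← Finset.mul_sum,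
    ← observableCost]
  linarith

lemma sum_coinExp_weighted_stepCost_le (h : P.Admissible m ε η α) :
    ∑ t ∈ Finset.Icc 1 P.T, (P.coinExp m ε fun β e =>
        (1 + 2 * (unsettledRun m β P.T t : ℝ)) * P.stepCost m η α t β e) ≤
      (1 + 144 * m ^ 2 * ε) * ∑ t ∈ Finset.Icc 1 P.T, P.expMean m ε η α t +
      (1 + 16 * m) * (diameter M * η * P.totalLoss m ε η α) +
      16 * m * (m * (2 * diameter M)) +
      128 * m * α * η * diameter M * (m * P.totalLoss m ε η α) := by
  have hD := h.diam_pos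
  have hα := h.α_pos
  have hη := h.η_nonneg
  have hearly : ∑ t ∈ Finset.Icc 1 P.T, (if t < m then 2 * diameter M else 0) ≤
      m * (2 * diameter M) := by
    refine (Finset.sum_le_sum fun t _ => ?_).trans
      (sum_Icc_ite_le (by positivity : 0 ≤ 2 * diameter M) P.T m)
    split_ifs <;> first | omega | positivity | exact le_rfl
  refine (Finset.sum_le_sum fun t ht => h.coinExp_weighted_stepCost_le ht).trans ?_
  simp only [Finset.sum_add_distrib, ← Finset.mul_sum]
  gcongr
  · exact h.sum_expLoss_sub_le 1
  · exact h.sum_sum_expLoss_le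

end Admissible

end Instance

end Total

section Tuned

/-- The relations between the parameters of the theorem on which its estimates rely. Here `V` is
the benchmark, and `γ` is the square root of `α`. -/
structure Tuned (D ℓ k m V γ ε η α : ℝ) : Prop where
  D_pos : 0 < D
  one_le_ℓ : 1 ≤ ℓ
  one_le_k : 1 ≤ k
  two_le_m : 2 ≤ m
  V_pos : 0 < V
  γ_pos : 0 < γ
  α_eq : α = γ ^ 2
  α_le : α ≤ 1 / 2
  sq_mul_ε : m ^ 2 * ε = γ
  budget : D * ℓ * k = α * ε * V
  exp_neg_η : Real.exp (-η) = 1 - γ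

namespace Tuned

variable {D ℓ k m V γ ε η α : ℝ}

lemma α_pos (h : Tuned D ℓ k m V γ ε η α) : 0 < α := h.α_eq ▸ pow_pos h.γ_pos 2

lemma γ_le (h : Tuned D ℓ k m V γ ε η α) : γ ≤ 3 / 4 :=
  le_of_sq_le_sq (by linarith [h.α_eq, h.α_le]) (by norm_num)

lemma ε_pos (h : Tuned D ℓ k m V γ ε η α) : 0 < ε :=
  pos_of_mul_pos_right (h.sq_mul_ε ▸ h.γ_pos) (sq_nonneg m)

lemma mε_le (h : Tuned D ℓ k m V γ ε η α) : m * ε ≤ γ / 2 := by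
  nlinarith [h.sq_mul_ε, mul_nonneg (by linarith [h.two_le_m] : 0 ≤ m) h.ε_pos.le, h.two_le_m]

lemma ε_le (h : Tuned D ℓ k m V γ ε η α) : ε ≤ γ / 4 := by
  nlinarith [h.mε_le, h.ε_pos, h.two_le_m]

lemma η_nonneg (h : Tuned D ℓ k m V γ ε η α) : 0 ≤ η := by
  have : Real.exp (-η) ≤ 1 := by linarith [h.exp_neg_η, h.γ_pos]
  linarith [Real.exp_le_one_iff.1 this]

lemma η_mul_le (h : Tuned D ℓ k m V γ ε η α) : η * (1 - γ) ≤ γ := by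
  have hexp : Real.exp η * (1 - γ) = 1 := by
    rw [← h.exp_neg_η, ← Real.exp_add, add_neg_cancel, Real.exp_zero]
  nlinarith [mul_le_mul_of_nonneg_right (Real.add_one_le_exp η)
    (by linarith [h.γ_le] : 0 ≤ 1 - γ)]

lemma η_le (h : Tuned D ℓ k m V γ ε η α) : η ≤ (1 + 12 * γ) * ((1 - α) * γ) := by
  have hγ := h.γ_pos
  have hγ' := h.γ_le
  have hη := h.η_nonneg
  have hα : 0 ≤ (1 - α) * γ := mul_nonneg (by linarith [h.α_le]) hγ.le
  have hinv : 1 ≤ (1 + 4 * γ) * (1 - γ) := by nlinarith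
  have hinv' : 1 ≤ (1 + 2 * γ) * (1 - α) := by
    have := h.α_le
    rw [h.α_eq] at this ⊢
    nlinarith
  calc η ≤ η * ((1 + 4 * γ) * (1 - γ)) := le_mul_of_one_le_right hη hinv
    _ = (1 + 4 * γ) * (η * (1 - γ)) := by ring
    _ ≤ (1 + 4 * γ) * γ := by gcongr; exact h.η_mul_le
    _ ≤ (1 + 4 * γ) * γ * ((1 + 2 * γ) * (1 - α)) := le_mul_of_one_le_right (by positivity) hinv'
    _ = (1 + 4 * γ) * (1 + 2 * γ) * ((1 - α) * γ) := by ring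
    _ ≤ (1 + 12 * γ) * ((1 - α) * γ) := by
        gcongr
        nlinarith

lemma mul_k_le (h : Tuned D ℓ k m V γ ε η α) : D * k ≤ γ * V := by
  have hD := h.D_pos
  have hk := h.one_le_k
  have hV := h.V_pos
  calc D * k ≤ D * k * ℓ := le_mul_of_one_le_right (by positivity) h.one_le_ℓ
    _ = α * ε * V := by rw [← h.budget]; ring
    _ ≤ γ * V := by
        gcongr
        nlinarith [h.α_le, h.ε_le, h.ε_pos, h.γ_pos]

lemma mul_sq_le (h : Tuned D ℓ k m V γ ε η α) : D * m ^ 2 ≤ γ * V := by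
  have hD := h.D_pos
  calc D * m ^ 2 ≤ D * m ^ 2 * (ℓ * k) := le_mul_of_one_le_right (by positivity)
        (one_le_mul_of_one_le_of_one_le h.one_le_ℓ h.one_le_k)
    _ = α * (γ * V) := by rw [← h.sq_mul_ε]; linear_combination m ^ 2 * h.budget
    _ ≤ γ * V := mul_le_of_le_one_left (mul_pos h.γ_pos h.V_pos).le (by linarith [h.α_le])

lemma log_two_le (h : Tuned D ℓ k m V γ ε η α) : Real.log 2 ≤ Real.log (ℓ / α) := by
  refine Real.log_le_log two_pos ?_
  rw [le_div_iff₀ h.α_pos]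
  linarith [h.α_le, h.one_le_ℓ]

lemma half_le_log (h : Tuned D ℓ k m V γ ε η α) : 1 / 2 ≤ Real.log (ℓ / α) := by
  linarith [h.log_two_le, Real.log_two_gt_d9]

lemma log_two_mul_le (h : Tuned D ℓ k m V γ ε η α) :
    Real.log (2 * ℓ / α) ≤ 2 * Real.log (ℓ / α) := by
  rw [mul_div_assoc, Real.log_mul two_ne_zero
    (div_pos (by linarith [h.one_le_ℓ]) h.α_pos).ne']
  linarith [h.log_two_le]

lemma switching_loss_le (h : Tuned D ℓ k m V γ ε η α) :
    2 * D * ℓ * ((k + 1) * Real.log (2 * ℓ / α)) ≤ 8 * (α * ε * V) * Real.log (ℓ / α) := by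
  have hD := h.D_pos
  have hℓ := h.one_le_ℓ
  have hk := h.one_le_k
  have hlog := h.half_le_log
  calc 2 * D * ℓ * ((k + 1) * Real.log (2 * ℓ / α))
      ≤ 2 * D * ℓ * ((2 * k) * (2 * Real.log (ℓ / α))) :=
        mul_le_mul_of_nonneg_left (mul_le_mul_of_nonneg (by linarith) h.log_two_mul_le
          (by positivity) (by positivity)) (by positivity)
    _ = _ := by rw [← h.budget]; ring

variable {A F Λ B S : ℝ}

lemma mul_observable_le (h : Tuned D ℓ k m V γ ε η α)
    (hregret : (1 - α) * γ * (ε / (2 * D * ℓ) * A) ≤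
      η * (ε / (2 * D * ℓ) * F) + (k + 1) * Real.log (2 * ℓ / α)) :
    (1 - α) * γ * A ≤ η * F + 8 * (α * V) * Real.log (ℓ / α) := by
  have hℓ := h.one_le_ℓ
  have hD := h.D_pos
  refine le_of_mul_le_mul_left ?_ h.ε_pos
  calc ε * ((1 - α) * γ * A)
      = 2 * D * ℓ * ((1 - α) * γ * (ε / (2 * D * ℓ) * A)) := by field_simp
    _ ≤ 2 * D * ℓ * (η * (ε / (2 * D * ℓ) * F) + (k + 1) * Real.log (2 * ℓ / α)) := by gcongr
    _ = ε * (η * F) + 2 * D * ℓ * ((k + 1) * Real.log (2 * ℓ / α)) := by field_simp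
    _ ≤ ε * (η * F) + 8 * (α * ε * V) * Real.log (ℓ / α) := by
        linarith [h.switching_loss_le]
    _ = _ := by ring

lemma observable_le (h : Tuned D ℓ k m V γ ε η α)
    (hregret : (1 - α) * γ * (ε / (2 * D * ℓ) * A) ≤
      η * (ε / (2 * D * ℓ) * F) + (k + 1) * Real.log (2 * ℓ / α))
    (hF : F ≤ (1 + 2 * γ) * V) :
    A ≤ V + 32 * (γ * V) + 16 * (γ * V * Real.log (ℓ / α)) := by
  have hγ := h.γ_pos
  have hV := h.V_pos
  have hη := h.η_nonneg
  have hlog := h.half_le_log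
  have hpos : 0 < (1 - α) * γ := mul_pos (by linarith [h.α_le]) hγ
  have hmain : A ≤ (1 + 12 * γ) * ((1 + 2 * γ) * V) + 16 * (γ * V * Real.log (ℓ / α)) := by
    refine le_of_mul_le_mul_left ?_ hpos
    have hshare : 8 * (α * V) * Real.log (ℓ / α) ≤
        (1 - α) * γ * (16 * (γ * V * Real.log (ℓ / α))) := by
      have hα := h.α_le
      have : 0 ≤ γ * (γ * V * Real.log (ℓ / α)) := by positivity
      have : 1 / 2 * (γ * (γ * V * Real.log (ℓ / α))) ≤
          (1 - α) * (γ * (γ * V * Real.log (ℓ / α))) := by gcongr; linarith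
      linarith [congrArg (· * V * Real.log (ℓ / α)) h.α_eq]
    calc (1 - α) * γ * A ≤ η * F + 8 * (α * V) * Real.log (ℓ / α) := h.mul_observable_le hregret
      _ ≤ (1 + 12 * γ) * ((1 - α) * γ) * ((1 + 2 * γ) * V) +
          (1 - α) * γ * (16 * (γ * V * Real.log (ℓ / α))) :=
        add_le_add (mul_le_mul_of_nonneg h.η_le hF hη (by positivity)) hshare
      _ = _ := by ring
  nlinarith [mul_le_mul_of_nonneg_right h.γ_le (mul_pos hγ hV).le]

lemma sq_mul_loss_le (h : Tuned D ℓ k m V γ ε η α) (hA : 0 ≤ A)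
    (hΛ : Λ = ε / (2 * D * ℓ) * A) : m ^ 2 * (D * η * Λ) ≤ 3 / 2 * (γ * A) := by
  have hD := h.D_pos
  have hℓ := h.one_le_ℓ
  have hε := h.ε_pos
  have hη : η ≤ 3 := by nlinarith [h.η_mul_le, h.γ_le, h.η_nonneg]
  calc m ^ 2 * (D * η * Λ) = η * (γ * A / (2 * ℓ)) := by
        rw [hΛ, ← h.sq_mul_ε]
        field_simp
    _ ≤ 3 * (γ * A / (2 * 1)) := by
        have := h.γ_pos
        gcongr
    _ = _ := by ring

lemma mul_loss_le (h : Tuned D ℓ k m V γ ε η α) (hA : 0 ≤ A)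
    (hΛ : Λ = ε / (2 * D * ℓ) * A) : m * (D * η * Λ) ≤ 3 / 4 * (γ * A) := by
  have hm := h.two_le_m
  have := h.sq_mul_loss_le hA hΛ
  have : 0 ≤ γ * A := mul_nonneg h.γ_pos.le hA
  refine le_of_mul_le_mul_left ?_ (by linarith : 0 < m)
  nlinarith

lemma mean_le (h : Tuned D ℓ k m V γ ε η α) (hA : 0 ≤ A) (hΛ : Λ = ε / (2 * D * ℓ) * A)
    (hB : B ≤ 2 * D * m + (1 + 8 * m * ε) * A + 8 * α * η * D * (m * Λ)) :
    B ≤ γ * V + A + 7 * (γ * A) := by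
  have hγA : 0 ≤ γ * A := mul_nonneg h.γ_pos.le hA
  have hblock : 2 * D * m ≤ γ * V := by
    nlinarith [h.mul_sq_le, mul_le_mul_of_nonneg_left h.two_le_m
      (mul_nonneg h.D_pos.le (by linarith [h.two_le_m] : 0 ≤ m))]
  have hexplore : m * ε * A ≤ γ / 2 * A := mul_le_mul_of_nonneg_right h.mε_le hA
  have hshare : α * (m * (D * η * Λ)) ≤ 1 / 2 * (3 / 4 * (γ * A)) :=
    mul_le_mul_of_nonneg h.α_le (h.mul_loss_le hA hΛ) h.α_pos.le (by positivity)
  linarith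

lemma total_le (h : Tuned D ℓ k m V γ ε η α) (hA : 0 ≤ A) (hΛ : Λ = ε / (2 * D * ℓ) * A)
    (hB : B ≤ 2 * D * m + (1 + 8 * m * ε) * A + 8 * α * η * D * (m * Λ))
    (hS : S ≤ (1 + 144 * m ^ 2 * ε) * B + (1 + 16 * m) * (D * η * Λ) + 16 * m * (m * (2 * D)) +
      128 * m * α * η * D * (m * Λ)) :
    S ≤ 141 * (γ * V) + (1 + 1016 * γ) * A := by
  have hγ := h.γ_pos
  have hγA : 0 ≤ γ * A := mul_nonneg hγ.le hA
  have hγV : 0 ≤ γ * V := mul_nonneg hγ.le h.V_pos.le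
  have hmean : (1 + 144 * m ^ 2 * ε) * B ≤ (1 + 144 * γ) * (γ * V + A + 7 * (γ * A)) := by
    rw [mul_assoc 144, h.sq_mul_ε]
    exact mul_le_mul_of_nonneg_left (h.mean_le hA hΛ hB) (by positivity)
  have hmovement : (1 + 16 * m) * (D * η * Λ) ≤ 13 * (γ * A) := by
    have hloss := h.mul_loss_le hA hΛ
    have : D * η * Λ ≤ γ * A := by
      nlinarith [h.two_le_m]
    linarith
  have hshare : α * (m ^ 2 * (D * η * Λ)) ≤ 1 / 2 * (3 / 2 * (γ * A)) :=
    mul_le_mul_of_nonneg h.α_le (h.sq_mul_loss_le hA hΛ) h.α_pos.le (by positivity)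
  have hγγV := mul_le_mul_of_nonneg_right h.γ_le hγV
  have hγγA := mul_le_mul_of_nonneg_right h.γ_le hγA
  linarith [h.mul_sq_le]

lemma total_le_benchmark (h : Tuned D ℓ k m V γ ε η α)
    (hA : A ≤ V + 32 * (γ * V) + 16 * (γ * V * Real.log (ℓ / α)))
    (hS : S ≤ 141 * (γ * V) + (1 + 1016 * γ) * A) :
    S ≤ V + 100000 * (γ * V * Real.log (ℓ / α)) := by
  have hγ := h.γ_pos
  have hlog := h.half_le_log
  have hγV : 0 < γ * V := mul_pos hγ h.V_pos
  have hA' := mul_le_mul_of_nonneg_left hA (by positivity : 0 ≤ 1 + 1016 * γ)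
  have hlog' : γ * V * (1 / 2) ≤ γ * V * Real.log (ℓ / α) := by gcongr
  have hγγV := mul_le_mul_of_nonneg_right h.γ_le hγV.le
  have hγγVlog := mul_le_mul_of_nonneg_right h.γ_le (by positivity :
    0 ≤ γ * V * Real.log (ℓ / α))
  linarith

end Tuned

end Tuned

section Benchmark

variable {M : Type*} [MetricSpace M] {ℓ k : ℕ}

namespace Instance

lemma offlineOpt_le_optLE (P : Instance M ℓ) (k : ℕ) : P.offlineOpt ≤ P.optLE k :=
  le_iInf₂ fun i _ => iInf₂_le (fun t => P.state (i t) t) (P.state_zero (i 0))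

lemma optLE_le_sum (P : Instance M ℓ) (k : ℕ) (i : Fin ℓ) :
    P.optLE k ≤ ∑ t ∈ Finset.Icc 1 P.T, P.f i t :=
  iInf₂_le (fun _ => i) (by simp)

lemma exists_pathCost_lt (P : Instance M ℓ) {c : ℝ≥0∞} (hc : P.optLE k < c) :
    ∃ i : ℕ → Fin ℓ, switches i P.T ≤ k ∧ P.pathCost (fun t => P.state (i t) t) < c := by
  simpa only [optLE, iInf_lt_iff, exists_prop, switches] using hc

lemma f_le_of_switch [BoundedSpace M] (P : Instance M ℓ) (i : ℕ → Fin ℓ) {t : ℕ} (ht : 1 ≤ t) :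
    P.f (i t) t ≤ P.c t (P.state (i t) t) + edist (P.state (i (t - 1)) (t - 1)) (P.state (i t) t) +
      if 2 ≤ t ∧ i (t - 1) ≠ i t then ENNReal.ofReal (diameter M) else 0 := by
  unfold Instance.f
  split_ifs with hswitch
  · rw [add_assoc]
    gcongr
    exact le_add_left (edist_le_diameter _ _)
  · rw [add_zero]
    by_cases h : i (t - 1) = i t
    · rw [h]
    · obtain rfl : t = 1 := by
        have : ¬ 2 ≤ t := fun h2 => hswitch ⟨h2, h⟩
        omega
      rw [Nat.sub_self, P.state_zero, P.state_zero]

lemma sum_f_le_pathCost [BoundedSpace M] (P : Instance M ℓ) (i : ℕ → Fin ℓ) :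
    ∑ t ∈ Finset.Icc 1 P.T, P.f (i t) t ≤
      P.pathCost (fun t => P.state (i t) t) + switches i P.T * ENNReal.ofReal (diameter M) := by
  refine (Finset.sum_le_sum fun t ht => P.f_le_of_switch i (Finset.mem_Icc.1 ht).1).trans ?_
  rw [Finset.sum_add_distrib, ← Finset.sum_filter, Finset.sum_const, nsmul_eq_mul]
  refine add_le_add le_rfl ?_
  gcongr
  refine Finset.card_le_card fun t ht => ?_
  simp only [Finset.mem_filter, Finset.mem_Icc] at ht ⊢
  exact ⟨⟨ht.2.1, ht.1.2⟩, ht.2.2⟩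

section

variable [NeZero ℓ] {P : Instance M ℓ}

lemma optLE_ne_top (hcost : ∀ i, ∀ t ∈ Finset.Icc 1 P.T, P.f i t ≤ ENNReal.ofReal (2 * diameter M))
    (k : ℕ) : P.optLE k ≠ ∞ :=
  ne_top_of_le_ne_top (ENNReal.sum_ne_top.2 fun t ht =>
    ne_top_of_le_ne_top ENNReal.ofReal_ne_top (hcost 0 t ht)) (P.optLE_le_sum k 0)

lemma optLE_toReal_pos
    (hcost : ∀ i, ∀ t ∈ Finset.Icc 1 P.T, P.f i t ≤ ENNReal.ofReal (2 * diameter M))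
    (hk : 1 ≤ k) (hopt : 2 * (k : ℝ≥0∞) ≤ P.offlineOpt) : 0 < (P.optLE k).toReal := by
  have hpos : (0 : ℝ≥0∞) < 2 * k := by
    simp only [CanonicallyOrderedAdd.mul_pos, Nat.cast_pos]
    exact ⟨two_pos, hk⟩
  exact ENNReal.toReal_pos (hpos.trans_le (hopt.trans (P.offlineOpt_le_optLE k))).ne'
    (optLE_ne_top hcost k)

lemma diameter_pos (hcost : ∀ i, ∀ t ∈ Finset.Icc 1 P.T, P.f i t ≤ ENNReal.ofReal (2 * diameter M))
    (hopt : P.optLE k ≠ 0) : 0 < diameter M := by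
  refine Metric.diam_nonneg.lt_of_ne' fun hD => hopt (le_bot_iff.1 ?_)
  refine (P.optLE_le_sum k 0).trans (Finset.sum_nonpos fun t ht => (hcost 0 t ht).trans_eq ?_)
  rw [diameter, hD, mul_zero, ENNReal.ofReal_zero]

end

end Instance

end Benchmark

section Parameters

variable {D ℓ k m V : ℝ}

lemma paramε_pos (hDℓk : 0 < D * ℓ * k) (hm : 0 < m) (hV : 0 < V) : 0 < paramε D ℓ k m V := by
  unfold paramε
  positivity

lemma paramε_pow_three (hDℓk : 0 < D * ℓ * k) (hm : 0 < m) (hV : 0 < V) :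
    m ^ 4 * paramε D ℓ k m V ^ 3 * V = D * ℓ * k := by
  have hcube {a : ℝ} (ha : 0 < a) (r : ℝ) : (a ^ r) ^ 3 = a ^ (r * 3) := by
    rw [← Real.rpow_natCast, ← Real.rpow_mul ha.le, Nat.cast_ofNat]
  rw [paramε, mul_pow, mul_pow, hcube hV, hcube hDℓk, hcube hm]
  norm_num
  rw [Real.rpow_neg_one]
  field_simp

lemma paramα_eq_sq (hDℓk : 0 < D * ℓ * k) (hm : 0 < m) (hV : 0 < V) :
    paramα D ℓ k m V = (m ^ 2 * paramε D ℓ k m V) ^ 2 := by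
  have hε := paramε_pos hDℓk hm hV
  rw [paramα, div_eq_iff (by positivity), ← paramε_pow_three hDℓk hm hV]
  ring

lemma exp_neg_paramη (hα : paramα D ℓ k m V ≤ 1 / 2) :
    Real.exp (-paramη D ℓ k m V) = 1 - √(paramα D ℓ k m V) := by
  have hsqrt : √(paramα D ℓ k m V) < 1 :=
    (Real.sqrt_lt' one_pos).2 (by linarith)
  rw [paramη, ← paramα, one_div, Real.log_inv, neg_neg, Real.exp_log (by linarith)]

lemma tuned_param (hD : 0 < D) (hℓ : 1 ≤ ℓ) (hk : 1 ≤ k) (hm : 2 ≤ m) (hV : 0 < V)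
    (hα : paramα D ℓ k m V ≤ 1 / 2) :
    Tuned D ℓ k m V (m ^ 2 * paramε D ℓ k m V) (paramε D ℓ k m V) (paramη D ℓ k m V)
      (paramα D ℓ k m V) := by
  have hDℓk : 0 < D * ℓ * k := by positivity
  have hm' : 0 < m := by linarith
  have hε := paramε_pos hDℓk hm' hV
  have hγ : 0 < m ^ 2 * paramε D ℓ k m V := by positivity
  have hsq := paramα_eq_sq hDℓk hm' hV
  refine ⟨hD, hℓ, hk, hm, hV, hγ, hsq, hα, rfl, ?_, ?_⟩
  · rw [paramα]
    field_simp
  · rw [exp_neg_paramη hα, hsq, Real.sqrt_sq hγ.le]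

lemma rpow_mul_eq_paramε_mul (hm : 0 < m) (hV : 0 < V) :
    (D * ℓ * k) ^ (1 / 3 : ℝ) * m ^ (2 / 3 : ℝ) * V ^ (2 / 3 : ℝ) =
      m ^ 2 * paramε D ℓ k m V * V := by
  have hm2 : m ^ (2 / 3 : ℝ) = m ^ 2 * m ^ (-(4 / 3) : ℝ) := by
    rw [← Real.rpow_natCast, ← Real.rpow_add hm]
    norm_num
  have hV1 : V ^ (2 / 3 : ℝ) = V ^ (-(1 / 3) : ℝ) * V := by
    rw [← Real.rpow_add_one hV.ne']
    norm_num
  rw [paramε, hm2, hV1]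
  ring

lemma rpow_div_eq_div_paramα (hD : 0 < D) (hℓ : 0 < ℓ) (hk : 0 < k) (hm : 0 < m) (hV : 0 < V) :
    ℓ ^ (1 / 3 : ℝ) * V ^ (2 / 3 : ℝ) / ((D * k) ^ (2 / 3 : ℝ) * m ^ (4 / 3 : ℝ)) =
      ℓ / paramα D ℓ k m V := by
  have hpow {a : ℝ} (ha : 0 < a) (r : ℝ) (n : ℕ) : a ^ (r * n) = (a ^ r) ^ n := by
    rw [Real.rpow_mul ha.le, Real.rpow_natCast]
  have hcube {a : ℝ} (ha : 0 < a) : (a ^ (1 / 3 : ℝ)) ^ 3 = a := by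
    rw [← hpow ha]
    norm_num
  have hDk : 0 < D * k := mul_pos hD hk
  set d := (D * k) ^ (1 / 3 : ℝ) with hd
  set a := ℓ ^ (1 / 3 : ℝ) with ha
  set μ := m ^ (2 / 3 : ℝ) with hμ
  set v := V ^ (1 / 3 : ℝ) with hv
  have hα : paramα D ℓ k m V = (d * a * μ / v) ^ 2 := by
    rw [paramα_eq_sq (by positivity) hm hV]
    congr 1
    have hroot : (D * ℓ * k) ^ (1 / 3 : ℝ) = d * a := by
      rw [hd, ha, ← Real.mul_rpow hDk.le hℓ.le, mul_right_comm]
    have hV2 : V ^ (2 / 3 : ℝ) = v ^ 2 := by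
      rw [hv, ← hpow hV]
      norm_num
    have hv0 : 0 < v := by positivity
    rw [eq_div_iff hv0.ne', ← mul_left_inj' (pow_pos hv0 2).ne', ← hV2, hμ, ← hroot,
      rpow_mul_eq_paramε_mul hm hV, hV2, mul_assoc, ← pow_succ', hv, hcube hV]
  calc a * V ^ (2 / 3 : ℝ) / ((D * k) ^ (2 / 3 : ℝ) * m ^ (4 / 3 : ℝ))
      = a * v ^ 2 / (d ^ 2 * μ ^ 2) := by
        rw [hd, hμ, hv, ← hpow hV, ← hpow hDk, ← hpow hm]
        norm_num
    _ = a ^ 3 / (d * a * μ / v) ^ 2 := by field_simp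
    _ = ℓ / paramα D ℓ k m V := by rw [hα, ha, hcube hℓ]

end Parameters

namespace Instance

section

variable {M : Type*} [MetricSpace M] {ℓ k m : ℕ} {P : Instance M ℓ} {V γ ε η α : ℝ}

lemma Admissible.of_tuned (h : Tuned (diameter M) ℓ k m V γ ε η α)
    (hcost : ∀ i, ∀ t ∈ Finset.Icc 1 P.T, P.f i t ≤ ENNReal.ofReal (2 * diameter M)) :
    P.Admissible m ε η α where
  two_le := by exact_mod_cast h.two_le_m
  diam_pos := h.D_pos
  cost_le := hcost
  η_nonneg := h.η_nonneg
  quarter_le_exp := by linarith [h.exp_neg_η, h.γ_le]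
  α_pos := h.α_pos
  α_le := h.α_le
  ε_pos := h.ε_pos
  mε_le := by linarith [h.mε_le, h.γ_le]

variable [BoundedSpace M]

lemma exists_sum_toReal_le (h : Tuned (diameter M) ℓ k m V γ ε η α)
    (hV : P.optLE k = ENNReal.ofReal V) :
    ∃ i : ℕ → Fin ℓ, switches i P.T ≤ k ∧
      ∑ t ∈ Finset.Icc 1 P.T, (P.f (i t) t).toReal ≤ (1 + 2 * γ) * V := by
  have hγV := mul_pos h.γ_pos h.V_pos
  have hV0 := h.V_pos
  have hD := h.D_pos
  obtain ⟨i, hi, hpath⟩ := P.exists_pathCost_lt (k := k) (c := ENNReal.ofReal (V + γ * V)) (by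
    rw [hV]
    exact (ENNReal.ofReal_lt_ofReal_iff (by positivity)).2 (by linarith))
  have hsum : ∑ t ∈ Finset.Icc 1 P.T, P.f (i t) t ≤ ENNReal.ofReal ((1 + 2 * γ) * V) := by
    calc ∑ t ∈ Finset.Icc 1 P.T, P.f (i t) t
        ≤ P.pathCost (fun t => P.state (i t) t) +
          switches i P.T * ENNReal.ofReal (diameter M) := P.sum_f_le_pathCost i
      _ ≤ ENNReal.ofReal (V + γ * V) + k * ENNReal.ofReal (diameter M) := by gcongr
      _ = ENNReal.ofReal (V + γ * V + k * diameter M) := by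
          rw [ENNReal.ofReal_add (p := V + γ * V) (by positivity) (by positivity),
            ENNReal.ofReal_mul (Nat.cast_nonneg k), ENNReal.ofReal_natCast]
      _ ≤ ENNReal.ofReal ((1 + 2 * γ) * V) :=
          ENNReal.ofReal_le_ofReal (by linarith [h.mul_k_le])
  refine ⟨i, hi, ?_⟩
  rw [← ENNReal.toReal_sum fun t ht =>
    ENNReal.sum_ne_top.1 (ne_top_of_le_ne_top ENNReal.ofReal_ne_top hsum) t ht]
  exact ENNReal.toReal_le_of_le_ofReal (by have := h.γ_pos; positivity) hsum

variable [NeZero ℓ] {τ : (Fin ℓ → ℝ) → (Fin ℓ → ℝ) → Fin ℓ → Fin ℓ → ℝ} {greedy : ℕ → M → M}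

lemma Admissible.observableCost_le (hP : P.Admissible m ε η α)
    (h : Tuned (diameter M) ℓ k m V γ ε η α) (hV : P.optLE k = ENNReal.ofReal V) :
    P.observableCost m ε η α ≤ V + 32 * (γ * V) + 16 * (γ * V * Real.log (ℓ / α)) := by
  obtain ⟨i, hi, hF⟩ := P.exists_sum_toReal_le h hV
  have hregret := hP.totalLoss_le i
  rw [hP.totalLoss_eq, h.exp_neg_η, sub_sub_cancel] at hregret
  have hlog : 0 ≤ Real.log (2 * ℓ / α) := Real.log_nonneg <| by
    rw [one_le_div h.α_pos]
    linarith [h.α_le, h.one_le_ℓ]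
  refine h.observable_le (hregret.trans ?_) hF
  gcongr

lemma Admissible.expectedCost_le_optLE_add (hP : P.Admissible m ε η α)
    (h : Tuned (diameter M) ℓ k m V γ ε η α) (hV : P.optLE k = ENNReal.ofReal V)
    (hτ : IsOptimalPlan τ) (hg : P.IsGreedy greedy) :
    P.expectedCost m ε η α τ greedy ≤
      P.optLE k + ENNReal.ofReal (100000 * (γ * V * Real.log (ℓ / α))) := by
  have hregret : 0 ≤ 100000 * (γ * V * Real.log (ℓ / α)) := by
    have := h.γ_pos
    have := h.V_pos
    have := h.half_le_log
    positivity
  rw [hV, ← ENNReal.ofReal_add h.V_pos.le hregret]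
  exact (hP.expectedCost_le hτ hg).trans <| ENNReal.ofReal_le_ofReal <|
    h.total_le_benchmark (hP.observableCost_le h hV) <|
      h.total_le hP.observableCost_nonneg hP.totalLoss_eq hP.sum_expMean_le
        hP.sum_coinExp_weighted_stepCost_le

end

end Instance

end MTS

theorem theorem2_general :
    ∃ C : ℝ, 0 < C ∧
      ∀ (M : Type*) [MetricSpace M] [BoundedSpace M]
        (ℓ : ℕ) [NeZero ℓ] (m k : ℕ) (_ : 2 ≤ m) (_ : 1 ≤ k)
        (P : MTS.Instance M ℓ) (D V : ℝ)
        (_ : D = MTS.diameter M)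
        (_ : V = (P.optLE k).toReal)
        (_ : ∀ i, ∀ t ∈ Finset.Icc 1 P.T, P.f i t ≤ ENNReal.ofReal (2 * D))
        (_ : 0 < V)
        (_ : MTS.paramα D ℓ k m V ≤ 1 / 2)
        (τ : (Fin ℓ → ℝ) → (Fin ℓ → ℝ) → Fin ℓ → Fin ℓ → ℝ) (_ : MTS.IsOptimalPlan τ)
        (greedy : ℕ → M → M) (_ : P.IsGreedy greedy),
        P.expectedCost m (MTS.paramε D ℓ k m V) (MTS.paramη D ℓ k m V) (MTS.paramα D ℓ k m V)
            τ greedy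
          ≤ P.optLE k + ENNReal.ofReal
              (C * ((D * ℓ * k) ^ (1 / 3 : ℝ) * (m : ℝ) ^ (2 / 3 : ℝ) * V ^ (2 / 3 : ℝ)
                * Real.log ((ℓ : ℝ) ^ (1 / 3 : ℝ) * V ^ (2 / 3 : ℝ)
                    / ((D * k) ^ (2 / 3 : ℝ) * (m : ℝ) ^ (4 / 3 : ℝ))))) := by
  refine ⟨100000, by norm_num, ?_⟩
  rintro M _ _ ℓ _ m k hm hk P _ V rfl hVdef hcost hV hα τ hτ greedy hg
  obtain ⟨hopt, hfinite⟩ := ENNReal.toReal_pos_iff.1 (hVdef ▸ hV)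
  have hVopt : P.optLE k = ENNReal.ofReal V := by rw [hVdef, ENNReal.ofReal_toReal hfinite.ne]
  have hD := MTS.Instance.diameter_pos hcost hopt.ne'
  have hℓ : (1 : ℝ) ≤ ℓ := Nat.one_le_cast.2 NeZero.one_le
  have hk' : (1 : ℝ) ≤ k := Nat.one_le_cast.2 hk
  have hm' : (2 : ℝ) ≤ m := Nat.ofNat_le_cast.2 hm
  have htuned := MTS.tuned_param hD hℓ hk' hm' hV hα
  rw [MTS.rpow_mul_eq_paramε_mul (by positivity) hV,
    MTS.rpow_div_eq_div_paramα hD (by positivity) (by positivity) (by positivity) hV]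
  exact (MTS.Instance.Admissible.of_tuned htuned hcost).expectedCost_le_optLE_add htuned hVopt
    hτ hg

theorem theorem2 :
    ∃ C : ℝ, 0 < C ∧
      ∀ (M : Type*) [MetricSpace M] [BoundedSpace M]
        (ℓ : ℕ) [NeZero ℓ] (m k : ℕ) (_ : 2 ≤ m) (_ : 1 ≤ k)
        (P : MTS.Instance M ℓ) (D V : ℝ)
        (_ : D = MTS.diameter M)
        (_ : V = (P.optLE k).toReal)
        -- the cost of each heuristic in each step is in `[0, 2D]`
        (_ : ∀ i, ∀ t ∈ Finset.Icc 1 P.T, P.f i t ≤ ENNReal.ofReal (2 * D))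
        -- the offline optimum is at least `2k`
        (_ : 2 * (k : ENNReal) ≤ P.offlineOpt)
        -- the parameters are admissible for SHARE
        (_ : MTS.paramα D ℓ k m V ≤ 1 / 2)
        (τ : (Fin ℓ → ℝ) → (Fin ℓ → ℝ) → Fin ℓ → Fin ℓ → ℝ) (_ : MTS.IsOptimalPlan τ)
        (greedy : ℕ → M → M) (_ : P.IsGreedy greedy),
        P.expectedCost m (MTS.paramε D ℓ k m V) (MTS.paramη D ℓ k m V) (MTS.paramα D ℓ k m V)
            τ greedy
          ≤ P.optLE k + ENNReal.ofReal
              (C * ((D * ℓ * k) ^ (1 / 3 : ℝ) * (m : ℝ) ^ (2 / 3 : ℝ) * V ^ (2 / 3 : ℝ)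
                * Real.log ((ℓ : ℝ) ^ (1 / 3 : ℝ) * V ^ (2 / 3 : ℝ)
                    / ((D * k) ^ (2 / 3 : ℝ) * (m : ℝ) ^ (4 / 3 : ℝ))))) := by
  obtain ⟨C, hC, hbound⟩ := theorem2_general
  refine ⟨C, hC, ?_⟩
  rintro M _ _ ℓ _ m k hm hk P _ _ rfl rfl hcost hopt
  exact hbound M ℓ m k hm hk P _ _ rfl rfl hcost (MTS.Instance.optLE_toReal_pos hcost hk hopt)
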